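/- For $m \ge 3$ let $C_m^{\square}$ denote the prism graph, that is, the graph with vertices $a_1,\dots,a_m,b_1,\dots,b_m$ in which $a_1a_2\cdots a_m$ and $b_1b_2\cdots b_m$ are two vertex-disjoint $m$-cycles and, besides the edges of these two cycles, exactly the edges $a_ib_i$ ($1 \le i \le m$) are present. Graphs are finite and simple, and a graph is called $K_{s,s}$-free if it has no (not necessarily induced) subgraph isomorphic to the complete bipartite graph $K_{s,s}$. Theorem. For every integer $\ell \ge 10$ there exists a constant $C = C(\ell) > 0$, depending only on $\ell$, such that for all integers $s \ge 2$ and $n \ge 1$ the following holds: every $n$-vertex $K_{s,s}$-free graph $G$ with $$e(G) \ge C \cdot 6^{s} s^{20\ell^2} \cdot n^{3/2}$$ edges contains an induced subgraph isomorphic to $C_{2\ell}^{\square}$. -/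

import Mathlib

/-- The prism graph on two `m`-cycles: two vertex-disjoint copies of the `m`-cycle, on the vertex
sets `Fin m × {0}` and `Fin m × {1}`, together with the perfect matching that joins each vertex
`(i, 0)` to its counterpart `(i, 1)`. -/
def prismGraph (m : ℕ) : SimpleGraph (Fin m × Fin 2) :=
  (SimpleGraph.cycleGraph m).boxProd (⊤ : SimpleGraph (Fin 2))

/-! ### Prisms as cyclic families of rungs, and greedy independent choices in `K_{s,s}`-free graphs
-/

section
open scoped Classical
open Finset

variable {V : Type*} [Fintype V]

/-! The prism over an even cycle is bipartite. After exchanging the ends of every second rung it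
becomes a cyclic family of rungs `(x_i, y_i)`, with `x_j` adjacent to `y_i` exactly when `i = j` or
`i`, `j` are consecutive, and with no edges among the `x_i` or among the `y_i`. A prism is thus a
closed walk of length `2ℓ` on the darts of `G`, consecutive darts spanning an induced 4-cycle, such
that darts at non-consecutive positions have no edges between them.

Local density yields a prism directly. If every triple in a large set has many common neighbours, a
typical independent tuple of `x`'s can be completed greedily, because in a `K_{s,s}`-free graph
fewer than `s` vertices dominate a given large set (`exists_induced_pattern`). Hence in a prism-free
graph every set `S` has at most `|S|^3 M` vertices with `B` or more neighbours in it
(`prism_of_small_set`), and every set `W` spans only `O(|W|^{7/4})` edges (`prism_of_dense`).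

In the remaining, locally sparse case, pass to an almost regular subgraph of degree about `D`, with
`D^2` at least a large multiple of its order (`exists_almost_regular_subset`). Join the darts `(x,
y)` and `(x', y')` of a 4-cycle with weight `1 / codeg(y, y')`, discarding small codegrees, chords
and overloaded continuations. Local sparsity shows that the average row sum is still of order `D`
(`card_mul_le_sum_dartMatrix`), while the weight from a dart to darts with a prescribed first or
second vertex is at most `θ`, of order `D / g`, where `g` is about `(D / M)^{1/3}`.

Closed walks of length `2k`, with `k = ℓ`, are counted by `closedWalkSum A k`, the trace of
`A^{2k}`. Cauchy–Schwarz and log-convexity of these traces show that walks with common ends seldom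
agree at an intermediate vertex (`collisionSum_sq_le`, `collisionSum_le`). So, given two opposite
points of a closed walk, the vertices on its two halves are independent and spread out, and since
small sets are sparse they are rarely adjacent (`sum_adj_pow_mul_pow_le`). A union bound over pairs
of positions leaves a conflict-free closed walk. Absorbing the number of darts, which is `O(g^9)`,
needs `g^k ≥ g^10`: this is where `ℓ ≥ 10` enters. All constants are polynomial in `s`, so `6^s`
dominates them. -/

theorem cycleGraph_adj_iff_val {m : ℕ} (hm : 2 ≤ m) (i j : Fin m) :
    (SimpleGraph.cycleGraph m).Adj i j ↔
      (i.val + 1 = j.val ∨ j.val + 1 = i.val ∨ (i.val = 0 ∧ j.val + 1 = m) ∨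
        (j.val = 0 ∧ i.val + 1 = m)) := by
  have hi := i.isLt
  have hj := j.isLt
  rw [SimpleGraph.cycleGraph_adj']
  rcases lt_trichotomy i j with h | h | h
  · rw [Fin.sub_val_of_le h.le, Fin.coe_sub_iff_lt.2 h]
    have : i.val < j.val := h
    omega
  · subst h
    have : NeZero m := ⟨by omega⟩
    rw [sub_self, Fin.val_zero]
    omega
  · rw [Fin.sub_val_of_le h.le, Fin.coe_sub_iff_lt.2 h]
    have : j.val < i.val := h
    omega

/-- A family of rungs `x i`, `y i` of `G` whose adjacencies follow the pattern of the prism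
gives an induced prism. -/
theorem prism_isIndContained_of_rungs {V : Type*} {G : SimpleGraph V} {ℓ : ℕ} (hℓ : 2 ≤ ℓ)
    (x y : Fin (2 * ℓ) → V)
    (hxy : ∀ i j, G.Adj (x j) (y i) ↔ (j = i ∨ (SimpleGraph.cycleGraph (2 * ℓ)).Adj j i))
    (hx : ∀ i j, ¬ G.Adj (x i) (x j)) (hy : ∀ i j, ¬ G.Adj (y i) (y j)) :
    (prismGraph (2 * ℓ)).IsIndContained G := by
  have hadj := cycleGraph_adj_iff_val (m := 2 * ℓ) (by omega)
  have key : ∀ i j, (SimpleGraph.cycleGraph (2 * ℓ)).Adj i j → (i.val % 2 = 0 ↔ ¬ j.val % 2 = 0) := by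
    intro i j h
    rw [hadj] at h
    omega
  have hsymm : ∀ i j, (SimpleGraph.cycleGraph (2 * ℓ)).Adj i j ↔
      (SimpleGraph.cycleGraph (2 * ℓ)).Adj j i := fun i j => SimpleGraph.adj_comm _ _ _
  -- The ends of every second rung are exchanged, so that the `x`'s and the `y`'s fill the two
  -- colour classes of the prism.
  set f : Fin (2 * ℓ) × Fin 2 → V := fun p =>
    if (p.1.val % 2 = 0 ↔ p.2 = 0) then x p.1 else y p.1 with hf
  have hiff : ∀ p q, G.Adj (f p) (f q) ↔ (prismGraph (2 * ℓ)).Adj p q := by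
    rintro ⟨i, a⟩ ⟨j, b⟩
    have hk := key i j
    have hii : ¬ (SimpleGraph.cycleGraph (2 * ℓ)).Adj i i := SimpleGraph.irrefl _
    simp only [hf, prismGraph, SimpleGraph.boxProd_adj, SimpleGraph.top_adj]
    have hs := hsymm i j
    by_cases hA : (i.val % 2 = 0 ↔ a = 0) <;> by_cases hB : (j.val % 2 = 0 ↔ b = 0)
    · simp only [hA, hB, if_true, hx, false_iff]
      rintro (⟨h1, h2⟩ | ⟨h1, h2⟩)
      · have := hk h1
        subst h2
        tauto
      · subst h2
        apply h1
        have : a = 0 ↔ b = 0 := by tauto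
        omega
    · simp only [hA, hB, if_true, if_false, hxy]
      constructor
      · rintro (h | h)
        · subst h
          right
          refine ⟨?_, rfl⟩
          rintro rfl
          exact hB hA
        · left
          refine ⟨h, ?_⟩
          have := hk h
          have h' : a = 0 ↔ b = 0 := by tauto
          omega
      · rintro (⟨h1, h2⟩ | ⟨h1, h2⟩)
        · exact Or.inr h1
        · exact Or.inl h2
    · simp only [hA, hB, if_true, if_false, G.adj_comm (y i), hxy]
      constructor
      · rintro (h | h)
        · subst h
          right
          refine ⟨?_, rfl⟩
          rintro rfl
          exact hA hB
        · left
          rw [← hs] at h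
          refine ⟨h, ?_⟩
          have := hk h
          have h' : a = 0 ↔ b = 0 := by tauto
          omega
      · rintro (⟨h1, h2⟩ | ⟨h1, h2⟩)
        · exact Or.inr (hs.1 h1)
        · exact Or.inl h2.symm
    · simp only [hA, hB, if_false, hy, false_iff]
      rintro (⟨h1, h2⟩ | ⟨h1, h2⟩)
      · have := hk h1
        subst h2
        tauto
      · subst h2
        apply h1
        have : a = 0 ↔ b = 0 := by tauto
        omega
  refine ⟨⟨⟨f, ?_⟩, fun {p q} => hiff p q⟩⟩
  rintro ⟨i, a⟩ ⟨j, b⟩ hpq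
  -- Injectivity comes for free: vertices with the same image have the same neighbours, and a prism
  -- over a cycle of length at least 4 has no twins. Three neighbours of `(i, a)` suffice to see
  -- this.
  have h1 : ∀ q, (prismGraph (2 * ℓ)).Adj (i, a) q ↔ (prismGraph (2 * ℓ)).Adj (j, b) q := by
    intro q
    rw [← hiff, ← hiff, hpq]
  simp only [prismGraph, SimpleGraph.boxProd_adj, SimpleGraph.top_adj] at h1
  have hi := i.isLt
  have hj := j.isLt
  obtain ⟨p, hp⟩ : ∃ p : Fin (2 * ℓ), (i.val + 1 = 2 * ℓ ∧ p.val = 0) ∨ p.val = i.val + 1 := by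
    by_cases h : i.val + 1 = 2 * ℓ
    · exact ⟨⟨0, by omega⟩, Or.inl ⟨h, rfl⟩⟩
    · exact ⟨⟨i.val + 1, by omega⟩, Or.inr rfl⟩
  obtain ⟨q, hq⟩ : ∃ q : Fin (2 * ℓ), (i.val = 0 ∧ q.val + 1 = 2 * ℓ) ∨ q.val + 1 = i.val := by
    by_cases h : i.val = 0
    · exact ⟨⟨2 * ℓ - 1, by omega⟩, Or.inl ⟨h, by simp only; omega⟩⟩
    · exact ⟨⟨i.val - 1, by omega⟩, Or.inr (by simp only; omega)⟩
  obtain ⟨c, hc⟩ : ∃ c : Fin 2, c.val + a.val = 1 := ⟨⟨1 - a.val, by omega⟩, by simp only; omega⟩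
  have hpl := p.isLt
  have hql := q.isLt
  have e1 := (h1 (i, c)).1 (Or.inr ⟨fun h => by subst h; omega, rfl⟩)
  have e2 := (h1 (p, a)).1 (Or.inl ⟨by rw [hadj]; dsimp only; omega, rfl⟩)
  have e3 := (h1 (q, a)).1 (Or.inl ⟨by rw [hadj]; dsimp only; omega, rfl⟩)
  simp only [hadj, ne_eq, Fin.ext_iff] at e1 e2 e3
  simp only [Prod.mk.injEq, Fin.ext_iff]
  omega

/-- In a `K_{s,s}`-free graph, fewer than `s` vertices are adjacent to almost all of a given
set. -/
theorem card_dominating_lt {G : SimpleGraph V} {s : ℕ}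
    (hG : (completeBipartiteGraph (Fin s) (Fin s)).Free G) (A : Finset V) (hA : 2 * s ≤ #A) :
    #{v | 2 * s * #{a ∈ A | ¬ G.Adj v a} < #A} < s := by
  by_contra hcon
  push Not at hcon
  obtain ⟨D, hD, hDs⟩ := Finset.exists_subset_card_eq hcon
  -- Each of the `s` vertices of `D` misses less than a `1/(2s)` fraction of `A`, so together they
  -- miss at most half; the rest is the other side of a `K_{s,s}`.
  have hmiss : #{a ∈ A | ¬ ∀ v ∈ D, G.Adj v a} ≤ ∑ v ∈ D, #{a ∈ A | ¬ G.Adj v a} := by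
    refine le_trans (Finset.card_le_card ?_) Finset.card_biUnion_le
    intro a ha
    simp only [mem_filter, mem_biUnion, not_forall] at ha ⊢
    obtain ⟨h1, v, hv, h2⟩ := ha
    exact ⟨v, hv, h1, h2⟩
  have hsum : 2 * s * ∑ v ∈ D, #{a ∈ A | ¬ G.Adj v a} ≤ s * #A := by
    rw [Finset.mul_sum, ← hDs, ← smul_eq_mul (#D) (#A)]
    refine Finset.sum_le_card_nsmul _ _ _ fun v hv => ?_
    have := hD hv
    simp only [mem_filter, mem_univ, true_and] at this
    rw [hDs]
    exact this.le
  have hsplit := Finset.card_filter_add_card_filter_not (s := A) (fun a => ∀ v ∈ D, G.Adj v a)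
  have hbig : s ≤ #{a ∈ A | ∀ v ∈ D, G.Adj v a} := by
    rcases Nat.eq_zero_or_pos s with h0 | h0
    · omega
    · have : 2 * #{a ∈ A | ¬ ∀ v ∈ D, G.Adj v a} ≤ #A := by
        have h2 : s * (2 * #{a ∈ A | ¬ ∀ v ∈ D, G.Adj v a}) ≤ s * #A := by
          calc _ = 2 * s * #{a ∈ A | ¬ ∀ v ∈ D, G.Adj v a} := by ring
            _ ≤ _ := le_trans (Nat.mul_le_mul_left _ hmiss) hsum
        exact Nat.le_of_mul_le_mul_left h2 h0
      omega
  obtain ⟨R, hR, hRs⟩ := Finset.exists_subset_card_eq hbig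
  apply hG
  rw [SimpleGraph.completeBipartiteGraph_isContained_iff]
  refine ⟨D, R, by simpa using hDs, by simpa using hRs, ?_⟩
  intro v hv a ha
  have := hR ha
  simp only [mem_filter] at this
  exact this.2 v hv

/-- Large sets in a `K_{s,s}`-free graph have an independent transversal. -/
theorem exists_independent_transversal {G : SimpleGraph V} {s : ℕ} (hs : 1 ≤ s)
    (hG : (completeBipartiteGraph (Fin s) (Fin s)).Free G) (c : ℕ) (hc2 : 2 * s ≤ c) :
    ∀ m : ℕ, m * s ≤ c → ∀ A : Fin m → Finset V, (∀ i, (2 * s) ^ m * c ≤ #(A i)) →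
      ∃ y : Fin m → V, (∀ i, y i ∈ A i) ∧ ∀ i j, ¬ G.Adj (y i) (y j) := by
  intro m
  induction m with
  | zero => exact fun _ A _ => ⟨Fin.elim0, fun i => i.elim0, fun i => i.elim0⟩
  | succ m ih =>
    intro hm A hA
    have hAc : ∀ i, c ≤ #(A i) := fun i =>
      le_trans (Nat.le_mul_of_pos_left _ (by positivity)) (hA i)
    have hbad : #(univ.biUnion fun j : Fin m =>
        ({v | 2 * s * #{a ∈ A j.succ | ¬ G.Adj v a} < #(A j.succ)} : Finset V)) ≤ m * s := by
      refine le_trans (Finset.card_biUnion_le_card_mul _ _ s fun j _ => ?_) (by simp)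
      exact (card_dominating_lt hG _ (le_trans hc2 (hAc _))).le
    -- A vertex that dominates none of the later sets shrinks each of them by a factor of at most
    -- `2s`.
    obtain ⟨y0, hy0, hy0'⟩ : ∃ y0 ∈ A 0, y0 ∉ (univ.biUnion fun j : Fin m =>
        ({v | 2 * s * #{a ∈ A j.succ | ¬ G.Adj v a} < #(A j.succ)} : Finset V)) := by
      apply Finset.exists_mem_notMem_of_card_lt_card
      have := hAc 0
      have : (m + 1) * s = m * s + s := by ring
      omega
    simp only [mem_biUnion, mem_univ, true_and, mem_filter, not_exists, not_lt] at hy0'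
    obtain ⟨y, hyA, hyy⟩ := ih (by nlinarith) (fun j => {a ∈ A j.succ | ¬ G.Adj y0 a}) (by
      intro j
      have h1 := hy0' j
      have h2 := hA j.succ
      have h3 : 2 * s * ((2 * s) ^ m * c) ≤ 2 * s * #{a ∈ A j.succ | ¬ G.Adj y0 a} := by
        calc _ = (2 * s) ^ (m + 1) * c := by ring
          _ ≤ _ := h2.trans h1
      exact Nat.le_of_mul_le_mul_left h3 (by omega))
    simp only [mem_filter] at hyA
    refine ⟨Fin.cons y0 y, ?_, ?_⟩
    · intro i
      refine Fin.cases ?_ (fun j => ?_) i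
      · simpa using hy0
      · simpa using (hyA j).1
    · intro i j
      refine Fin.cases ?_ (fun i => ?_) i <;> refine Fin.cases ?_ (fun j => ?_) j
      · simp
      · simpa using (hyA j).2
      · simpa [G.adj_comm] using (hyA i).2
      · simpa using hyy i j

/-- The number of independent tuples in a large set of vertices of a `K_{s,s}`-free graph. -/
theorem card_independent_tuples {G : SimpleGraph V} {s : ℕ} (hs : 1 ≤ s)
    (hG : (completeBipartiteGraph (Fin s) (Fin s)).Free G) :
    ∀ (m : ℕ) (S : Finset V), (4 * s) ^ m ≤ #S →
      #S ^ m ≤ (4 * s) ^ (m ^ 2) * #{x ∈ Fintype.piFinset (fun _ : Fin m => S) |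
        ∀ i j, i ≠ j → x i ≠ x j ∧ ¬ G.Adj (x i) (x j)} := by
  intro m
  induction m with
  | zero => intro S _; simp
  | succ m ih =>
    intro S hS
    have h4 : 4 * s ≤ #S := le_trans (Nat.le_self_pow (by omega) _) hS
    set D : Finset V := {v | 2 * s * #{a ∈ S | ¬ G.Adj v a} < #S} with hD
    have hDs : #D < s := card_dominating_lt hG S (by omega)
    set T : V → Finset V := fun v => {a ∈ S | ¬ G.Adj v a}.erase v with hT
    -- The factor is `4s` instead of `2s` to pay for erasing `v` itself, using `4s ≤ #S`.
    have hTc : ∀ v ∈ S \ D, #S ≤ 4 * s * #(T v) := by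
      intro v hv
      simp only [hD, mem_sdiff, mem_filter, mem_univ, true_and, not_lt] at hv
      have h1 : #{a ∈ S | ¬ G.Adj v a} - 1 ≤ #(T v) := Finset.pred_card_le_card_erase
      have h2 : #{a ∈ S | ¬ G.Adj v a} ≤ #(T v) + 1 := by omega
      nlinarith [hv.2, Nat.mul_le_mul_left (2 * s) h2]
    set I : ∀ n : ℕ, Finset V → Finset (Fin n → V) := fun n S =>
      {x ∈ Fintype.piFinset (fun _ : Fin n => S) |
        ∀ i j, i ≠ j → x i ≠ x j ∧ ¬ G.Adj (x i) (x j)} with hI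
    have hcount : ∑ v ∈ S \ D, #(I m (T v)) ≤ #(I (m + 1) S) := by
      rw [← Finset.card_sigma]
      refine Finset.card_le_card_of_injOn (fun p => Fin.cons p.1 p.2) ?_ ?_
      · rintro ⟨v, x⟩ hp
        simp only [hI, hT, coe_sigma, Set.mem_sigma_iff, mem_coe, mem_sdiff, mem_filter,
          Fintype.mem_piFinset, mem_erase] at hp ⊢
        obtain ⟨⟨hv, -⟩, hx, hxx⟩ := hp
        constructor
        · intro i
          refine Fin.cases ?_ (fun i => ?_) i
          · simpa using hv
          · simpa using (hx i).2.1
        · intro i j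
          refine Fin.cases ?_ (fun i => ?_) i <;> refine Fin.cases ?_ (fun j => ?_) j
          · simp
          · intro _
            simpa using ⟨(hx j).1.symm, (hx j).2.2⟩
          · intro _
            simpa [G.adj_comm] using ⟨(hx i).1, (hx i).2.2⟩
          · intro hij
            simpa using hxx i j (fun h => hij (by rw [h]))
      · rintro ⟨v, x⟩ _ ⟨v', x'⟩ _ h
        have h' : (Fin.cons v x : Fin (m + 1) → V) = Fin.cons v' x' := h
        rw [Fin.cons_inj] at h'
        rw [h'.1, h'.2]
    have hterm : ∀ v ∈ S \ D, #S ^ m ≤ (4 * s) ^ (m ^ 2 + m) * #(I m (T v)) := by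
      intro v hv
      have h1 := hTc v hv
      have h2 : (4 * s) ^ m ≤ #(T v) := by
        have : 4 * s * (4 * s) ^ m ≤ 4 * s * #(T v) := by
          calc _ = (4 * s) ^ (m + 1) := by ring
            _ ≤ _ := hS.trans h1
        exact Nat.le_of_mul_le_mul_left this (by omega)
      calc #S ^ m ≤ (4 * s * #(T v)) ^ m := Nat.pow_le_pow_left h1 m
        _ = (4 * s) ^ m * #(T v) ^ m := by rw [mul_pow]
        _ ≤ (4 * s) ^ m * ((4 * s) ^ (m ^ 2) * #(I m (T v))) := Nat.mul_le_mul_left _ (ih _ h2)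
        _ = _ := by rw [pow_add]; ring
    have hhalf : #S ≤ 2 * #(S \ D) := by
      have := Finset.le_card_sdiff D S
      omega
    have hsum : #(S \ D) * #S ^ m ≤ (4 * s) ^ (m ^ 2 + m) * #(I (m + 1) S) := by
      calc #(S \ D) * #S ^ m = ∑ v ∈ S \ D, #S ^ m := by simp
        _ ≤ ∑ v ∈ S \ D, (4 * s) ^ (m ^ 2 + m) * #(I m (T v)) := Finset.sum_le_sum hterm
        _ = (4 * s) ^ (m ^ 2 + m) * ∑ v ∈ S \ D, #(I m (T v)) := by rw [Finset.mul_sum]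
        _ ≤ _ := Nat.mul_le_mul_left _ hcount
    calc #S ^ (m + 1) = #S * #S ^ m := by ring
      _ ≤ 2 * #(S \ D) * #S ^ m := Nat.mul_le_mul_right _ hhalf
      _ = 2 * (#(S \ D) * #S ^ m) := by ring
      _ ≤ 2 * ((4 * s) ^ (m ^ 2 + m) * #(I (m + 1) S)) := Nat.mul_le_mul_left _ hsum
      _ ≤ (4 * s) ^ (m + 1) * ((4 * s) ^ (m ^ 2 + m) * #(I (m + 1) S)) := by
        apply Nat.mul_le_mul_right
        calc 2 ≤ 4 * s := by omega
          _ ≤ _ := Nat.le_self_pow (by omega) _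
      _ = (4 * s) ^ ((m + 1) ^ 2) * #(I (m + 1) S) := by
        rw [← mul_assoc, ← pow_add]
        ring_nf

/-- Tuples with a property that, given all but one coordinate, holds for few values of the
remaining coordinate. -/
theorem card_tuples_le_of_coordinate {m : ℕ} (S : Finset V) (p : Fin (m + 1))
    (bad : (Fin (m + 1) → V) → Prop) (c : ℕ)
    (h : ∀ b : Fin m → V, #{v | bad (p.insertNth v b)} ≤ c) :
    #{x ∈ Fintype.piFinset (fun _ : Fin (m + 1) => S) | bad x} ≤ c * #S ^ m := by
  have hcard : #(Fintype.piFinset (fun _ : Fin m => S)) = #S ^ m := by simp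
  rw [← hcard]
  refine Finset.card_le_mul_card_image_of_maps_to (f := fun x => p.removeNth x) ?_ c ?_
  · intro x hx
    simp only [mem_filter, Fintype.mem_piFinset] at hx ⊢
    intro i
    exact hx.1 _
  · intro b _
    refine le_trans (Finset.card_le_card_of_injOn (fun x => x p) ?_ ?_) (h b)
    · intro x hx
      simp only [coe_filter, mem_filter, mem_univ, true_and, Set.mem_ofPred_eq] at hx ⊢
      obtain ⟨⟨-, h1⟩, h2⟩ := hx
      rw [← h2, Fin.insertNth_self_removeNth]
      exact h1
    · intro x hx x' hx' hxx
      simp only [coe_filter, mem_filter, Set.mem_ofPred_eq] at hx hx'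
      have e1 : p.insertNth (x p) (p.removeNth x) = x := Fin.insertNth_self_removeNth p x
      have e2 : p.insertNth (x' p) (p.removeNth x') = x' := Fin.insertNth_self_removeNth p x'
      rw [← e1, ← e2, hx.2, hx'.2]
      simp only at hxx
      rw [hxx]

end

/-! ### Induced patterns from triples with many common neighbours -/

section
open scoped Classical
open Finset

variable {V : Type*} [Fintype V]

/-- If all triples in a large set `S` have many common neighbours, then `S` contains the `x`-side of
any induced bipartite pattern whose `y`-side has degree three. -/
theorem exists_induced_pattern {G : SimpleGraph V} {s : ℕ} (hs : 1 ≤ s)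
    (hG : (completeBipartiteGraph (Fin s) (Fin s)).Free G) {m M : ℕ}
    (T : Fin (m + 1) → Finset (Fin (m + 1))) (hT : ∀ i, #(T i) = 3) (S : Finset V)
    (hS : (m + 1) * (m + 1) * s * (4 * s) ^ ((m + 1) ^ 2) < #S)
    (hM : (2 * s) ^ (m + 1) * ((2 * s) ^ (m + 1) * ((m + 3) * s)) ≤ M)
    (hcod : ∀ t ⊆ S, #t = 3 → M ≤ #{y | ∀ v ∈ t, G.Adj v y}) :
    ∃ x y : Fin (m + 1) → V, (∀ i j, G.Adj (x j) (y i) ↔ j ∈ T i) ∧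
      (∀ i j, ¬ G.Adj (x i) (x j)) ∧ (∀ i j, ¬ G.Adj (y i) (y j)) := by
  -- Candidates for `y i` when the required non-adjacencies have been imposed only for indices below
  -- `j`. A tuple is bad if the next such index removes almost all candidates.
  set A : (Fin (m + 1) → V) → Fin (m + 1) → ℕ → Finset V := fun x i j =>
    {y | (∀ a ∈ T i, G.Adj (x a) y) ∧ ∀ b : Fin (m + 1), b.val < j → b ∉ T i → ¬ G.Adj (x b) y}
    with hA
  set bad : Fin (m + 1) → Fin (m + 1) → (Fin (m + 1) → V) → Prop := fun i j x =>
    j ∉ T i ∧ 2 * s ≤ #(A x i j) ∧ 2 * s * #{a ∈ A x i j | ¬ G.Adj (x j) a} < #(A x i j) with hbad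
  have hbadc : ∀ i j, #{x ∈ Fintype.piFinset (fun _ : Fin (m + 1) => S) | bad i j x} ≤
      s * #S ^ m := by
    intro i j
    have hcoord := card_tuples_le_of_coordinate S j (bad i j) s ?_
    · convert hcoord
    intro b
    by_cases hj : j ∈ T i
    · simp [hbad, hj]
    rcases isEmpty_or_nonempty V with hV | ⟨⟨v₀⟩⟩
    · simp
    -- For `j ∉ T i` the candidate set does not involve the coordinate `x j`; hence, given the
    -- others, fewer than `s` values of `x j` are bad.
    have hAeq : ∀ v, A (j.insertNth v b) i j = A (j.insertNth v₀ b) i j := by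
      intro v
      have hne : ∀ a, a ≠ j → (j.insertNth v b : Fin (m + 1) → V) a =
          (j.insertNth v₀ b : Fin (m + 1) → V) a := by
        intro a ha
        obtain ⟨a', rfl⟩ := Fin.exists_succAbove_eq ha
        simp
      simp only [hA]
      ext y
      simp only [mem_filter, mem_univ, true_and]
      refine and_congr ?_ ?_
      · refine forall₂_congr fun a ha => ?_
        rw [hne a (fun h => hj (h ▸ ha))]
      · refine forall₃_congr fun a ha _ => ?_
        rw [hne a (fun h => by subst h; exact lt_irrefl _ ha)]
    by_cases hsize : 2 * s ≤ #(A (j.insertNth v₀ b) i j)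
    · refine le_trans (Finset.card_le_card ?_) (card_dominating_lt hG _ hsize).le
      intro v
      simp only [mem_filter, mem_univ, true_and, hbad, hAeq, Fin.insertNth_apply_same]
      exact fun h => h.2.2
    · simp [hbad, hAeq, hsize]
  set I : Finset (Fin (m + 1) → V) := {x ∈ Fintype.piFinset (fun _ : Fin (m + 1) => S) |
        ∀ i j, i ≠ j → x i ≠ x j ∧ ¬ G.Adj (x i) (x j)} with hI
  have hmany : #S ^ (m + 1) ≤ (4 * s) ^ ((m + 1) ^ 2) * #I := by
    apply card_independent_tuples hs hG
    refine le_trans (Nat.pow_le_pow_right (by omega) (Nat.le_self_pow (n := 2) (by norm_num) (m + 1))) ?_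
    exact le_trans (Nat.le_mul_of_pos_left _ (Nat.mul_pos (Nat.mul_pos (by omega) (by omega)) hs))
      hS.le
  have hunion : #(univ.biUnion fun p : Fin (m + 1) × Fin (m + 1) =>
      ({x ∈ Fintype.piFinset (fun _ : Fin (m + 1) => S) | bad p.1 p.2 x} : Finset _)) ≤
      (m + 1) * (m + 1) * (s * #S ^ m) := by
    refine le_trans (Finset.card_biUnion_le_card_mul _ _ _ fun p _ => hbadc p.1 p.2) ?_
    simp
  -- Bad tuples are of order `#S ^ m`, one power below the independent ones.
  obtain ⟨x, hxI, hxb⟩ : ∃ x ∈ I, x ∉ (univ.biUnion fun p : Fin (m + 1) × Fin (m + 1) =>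
      ({x ∈ Fintype.piFinset (fun _ : Fin (m + 1) => S) | bad p.1 p.2 x} : Finset _)) := by
    apply Finset.exists_mem_notMem_of_card_lt_card
    refine lt_of_le_of_lt hunion ?_
    by_contra hcon
    push Not at hcon
    have hSpos : 0 < #S ^ m := by
      have : 0 < #S := by omega
      positivity
    have h1 : #S ^ (m + 1) ≤ (m + 1) * (m + 1) * s * (4 * s) ^ ((m + 1) ^ 2) * #S ^ m := by
      calc _ ≤ _ := hmany
        _ ≤ (4 * s) ^ ((m + 1) ^ 2) * ((m + 1) * (m + 1) * (s * #S ^ m)) :=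
          Nat.mul_le_mul_left _ hcon
        _ = _ := by ring
    have h2 := Nat.mul_lt_mul_of_pos_right hS hSpos
    rw [pow_succ, mul_comm (#S ^ m)] at h1
    omega
  simp only [hI, mem_filter, Fintype.mem_piFinset] at hxI
  obtain ⟨hxS, hxind⟩ := hxI
  have hnb : ∀ i j, ¬ bad i j x := by
    intro i j hb
    apply hxb
    simp only [mem_biUnion, mem_univ, true_and, mem_filter, Fintype.mem_piFinset]
    exact ⟨(i, j), hxS, hb⟩
  have hinj : Function.Injective x := by
    intro i j hij
    by_contra h
    exact (hxind i j h).1 hij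
  have hxx : ∀ i j, ¬ G.Adj (x i) (x j) := by
    intro i j
    by_cases h : i = j
    · subst h; exact G.irrefl
    · exact (hxind i j h).2
  have hA0 : ∀ i, M ≤ #(A x i 0) := by
    intro i
    have h1 := hcod ((T i).image x) (by
      intro v hv
      obtain ⟨a, -, rfl⟩ := mem_image.1 hv
      exact hxS a) (by rw [card_image_of_injective _ hinj, hT])
    refine le_trans h1 (Finset.card_le_card ?_)
    intro y
    simp [hA]
  have hMs : (2 * s) ^ (m + 1) * (2 * s) ≤ M := by
    refine le_trans (Nat.mul_le_mul_left _ ?_) hM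
    calc 2 * s ≤ (m + 3) * s := Nat.mul_le_mul_right _ (by omega)
      _ ≤ _ := Nat.le_mul_of_pos_left _ (by positivity)
  have hAj : ∀ i, ∀ j ≤ m + 1, M ≤ (2 * s) ^ j * #(A x i j) := by
    intro i j
    induction j with
    | zero => intro _; simpa using hA0 i
    | succ j ih =>
      intro hj
      have h0 := ih (by omega)
      by_cases hjT : (⟨j, by omega⟩ : Fin (m + 1)) ∈ T i
      · have hsub : A x i j ⊆ A x i (j + 1) := by
          intro y
          simp only [hA, mem_filter, mem_univ, true_and]
          rintro ⟨h1, h2⟩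
          refine ⟨h1, fun b hb hbT => h2 b ?_ hbT⟩
          by_contra hcon
          have : b = ⟨j, by omega⟩ := Fin.ext (by simp only; omega)
          exact hbT (this ▸ hjT)
        calc M ≤ (2 * s) ^ j * #(A x i j) := h0
          _ ≤ (2 * s) ^ (j + 1) * #(A x i (j + 1)) :=
            Nat.mul_le_mul (Nat.pow_le_pow_right (by omega) (by omega)) (card_le_card hsub)
      · have hb := hnb i ⟨j, by omega⟩
        simp only [hbad, hjT, not_false_eq_true, true_and, not_and, not_lt] at hb
        have hbig : 2 * s ≤ #(A x i j) := by
          have h3 : (2 * s) ^ j * (2 * s) ≤ (2 * s) ^ j * #(A x i j) := by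
            refine le_trans ?_ (hMs.trans h0)
            exact Nat.mul_le_mul_right _ (Nat.pow_le_pow_right (by omega) (by omega))
          exact Nat.le_of_mul_le_mul_left h3 (by positivity)
        have hsub : {a ∈ A x i j | ¬ G.Adj (x ⟨j, by omega⟩) a} ⊆ A x i (j + 1) := by
          intro y
          simp only [hA, mem_filter, mem_univ, true_and]
          rintro ⟨⟨h1, h2⟩, h3⟩
          refine ⟨h1, fun b hb hbT => ?_⟩
          by_cases hbj : b.val = j
          · have : b = ⟨j, by omega⟩ := Fin.ext hbj
            rw [this]
            exact h3
          · exact h2 b (by omega) hbT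
        calc M ≤ (2 * s) ^ j * #(A x i j) := h0
          _ ≤ (2 * s) ^ j * (2 * s * #(A x i (j + 1))) :=
            Nat.mul_le_mul_left _ ((hb hbig).trans (Nat.mul_le_mul_left _ (card_le_card hsub)))
          _ = _ := by ring
  obtain ⟨y, hyA, hyy⟩ := exists_independent_transversal hs hG ((m + 3) * s)
    (Nat.mul_le_mul_right _ (by omega)) (m + 1) (Nat.mul_le_mul_right _ (by omega))
    (fun i => A x i (m + 1)) (by
      intro i
      exact Nat.le_of_mul_le_mul_left (hM.trans (hAj i (m + 1) le_rfl)) (by positivity))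
  refine ⟨x, y, ?_, hxx, hyy⟩
  intro i j
  have h := hyA i
  simp only [hA, mem_filter, mem_univ, true_and] at h
  constructor
  · intro hadj
    by_contra hj
    exact h.2 j j.isLt hj hadj
  · exact h.1 j

/-- The induced prism is found in a set in which all triples have many common neighbours. -/
theorem prism_of_rich_triples {G : SimpleGraph V} {s ℓ : ℕ} (hs : 1 ≤ s) (hℓ : 2 ≤ ℓ)
    (hG : (completeBipartiteGraph (Fin s) (Fin s)).Free G) {M : ℕ} (S : Finset V)
    (hS : (2 * ℓ) * (2 * ℓ) * s * (4 * s) ^ ((2 * ℓ) ^ 2) < #S)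
    (hM : (2 * s) ^ (2 * ℓ) * ((2 * s) ^ (2 * ℓ) * ((2 * ℓ + 2) * s)) ≤ M)
    (hcod : ∀ t ⊆ S, #t = 3 → M ≤ #{y | ∀ v ∈ t, G.Adj v y}) :
    (prismGraph (2 * ℓ)).IsIndContained G := by
  obtain ⟨m, hm⟩ : ∃ m, 2 * ℓ = m + 3 := ⟨2 * ℓ - 3, by omega⟩
  obtain ⟨x, y, hxy, hxx, hyy⟩ : ∃ x y : Fin (2 * ℓ) → V,
      (∀ i j, G.Adj (x j) (y i) ↔ (j = i ∨ (SimpleGraph.cycleGraph (2 * ℓ)).Adj j i)) ∧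
      (∀ i j, ¬ G.Adj (x i) (x j)) ∧ (∀ i j, ¬ G.Adj (y i) (y j)) := by
    rw [hm] at hS hM ⊢
    -- The pattern is the closed neighbourhood in the cycle, which has three elements.
    obtain ⟨x, y, hxy, hxx, hyy⟩ := exists_induced_pattern hs hG (m := m + 2) (M := M)
      (fun i => insert i ((SimpleGraph.cycleGraph (m + 3)).neighborFinset i)) (by
        intro i
        rw [Finset.card_insert_of_notMem (by simp)]
        have := SimpleGraph.cycleGraph_degree_three_le (v := i)
        rw [← SimpleGraph.card_neighborFinset_eq_degree] at this
        convert congrArg (· + 1) this) S hS hM hcod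
    refine ⟨x, y, fun i j => ?_, hxx, hyy⟩
    rw [hxy]
    simp [SimpleGraph.adj_comm]
  exact prism_isIndContained_of_rungs hℓ x y hxy hxx hyy

/-- If a small set `S` has many vertices with at least `B` neighbours in `S`, then there is an
induced prism. -/
theorem prism_of_small_set {G : SimpleGraph V} {s ℓ : ℕ} (hs : 1 ≤ s) (hℓ : 2 ≤ ℓ)
    (hG : (completeBipartiteGraph (Fin s) (Fin s)).Free G) {B M : ℕ} (S : Finset V)
    (hB : (2 * ℓ) * (2 * ℓ) * s * (4 * s) ^ ((2 * ℓ) ^ 2) < B)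
    (hM : (2 * s) ^ (2 * ℓ) * ((2 * s) ^ (2 * ℓ) * ((2 * ℓ + 2) * s)) ≤ M)
    (hS : #S ^ 3 * M < #{y | B ≤ #{a ∈ S | G.Adj y a}}) :
    (prismGraph (2 * ℓ)).IsIndContained G := by
  by_contra hno
  have hpoor : ∀ y ∈ ({y | B ≤ #{a ∈ S | G.Adj y a}} : Finset V),
      ∃ t ⊆ {a ∈ S | G.Adj y a}, #t = 3 ∧ #{z | ∀ v ∈ t, G.Adj v z} < M := by
    intro y hy
    by_contra hcon
    push Not at hcon
    simp only [mem_filter, mem_univ, true_and] at hy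
    exact hno (prism_of_rich_triples hs hℓ hG _ (lt_of_lt_of_le hB hy) hM hcon)
  choose! t ht ht3 htM using hpoor
  -- Every `y` is charged to a poor triple among its neighbours in `S`. As `y` is a common neighbour
  -- of that triple, no triple is charged more than `M` times.
  have hcard : #{y | B ≤ #{a ∈ S | G.Adj y a}} ≤ M * #(S.powersetCard 3) := by
    refine Finset.card_le_mul_card_image_of_maps_to (f := t) ?_ M ?_
    · intro y hy
      rw [mem_powersetCard]
      exact ⟨(ht y hy).trans (filter_subset _ _), ht3 y hy⟩
    · intro b _
      rcases Finset.eq_empty_or_nonempty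
        ({a ∈ ({y | B ≤ #{a ∈ S | G.Adj y a}} : Finset V) | t a = b}) with h | ⟨y, hy⟩
      · rw [h]; simp
      · rw [mem_filter] at hy
        have h1 := htM y hy.1
        rw [hy.2] at h1
        refine le_trans (card_le_card ?_) h1.le
        intro z hz
        rw [mem_filter] at hz
        simp only [mem_filter, mem_univ, true_and]
        intro v hv
        have := ht z hz.1 (hz.2 ▸ hv)
        exact (mem_filter.1 this).2.symm
  rw [card_powersetCard] at hcard
  have h3 : (#S).choose 3 ≤ #S ^ 3 := Nat.choose_le_pow _ _
  have := Nat.mul_le_mul_left M h3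
  rw [mul_comm M (#S ^ 3)] at this
  omega

end

/-! ### Sparsity of vertex sets, and its form for spread-out weights -/

section
open scoped Classical
open Finset

variable {V : Type*} [Fintype V]

/-- The number of ordered pairs of adjacent vertices in `W`. -/
noncomputable def adjPairs {V : Type*} (G : SimpleGraph V) (W : Finset V) : ℕ :=
  #{p ∈ W ×ˢ W | G.Adj p.1 p.2}

theorem adjPairs_eq_sum {V : Type*} (G : SimpleGraph V) (W : Finset V) :
    adjPairs G W = ∑ v ∈ W, #{a ∈ W | G.Adj v a} := by
  simp only [adjPairs, card_filter, sum_product]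

theorem adjPairs_le_sq {V : Type*} (G : SimpleGraph V) (W : Finset V) :
    adjPairs G W ≤ #W ^ 2 := by
  refine (card_filter_le _ _).trans ?_
  rw [card_product, sq]

theorem adjPairs_mono {V : Type*} (G : SimpleGraph V) {W W' : Finset V} (h : W ⊆ W') :
    adjPairs G W ≤ adjPairs G W' :=
  card_le_card (filter_subset_filter _ (product_subset_product h h))

/-- A set contains subsets of every smaller size on which a function has at least its average. -/
theorem exists_subset_card_eq_sum_ge {V : Type*} (f : V → ℕ) (g : ℕ) :
    ∀ (d : ℕ) (W : Finset V), #W = g + d →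
      ∃ S ⊆ W, #S = g ∧ g * ∑ v ∈ W, f v ≤ #W * ∑ v ∈ S, f v := by
  intro d
  induction d with
  | zero => exact fun W hW => ⟨W, Subset.rfl, hW, by rw [hW]; simp⟩
  | succ d ih =>
    intro W hW
    have hne : W.Nonempty := card_pos.1 (by omega)
    obtain ⟨v, hv, hmin⟩ := exists_min_image W f hne
    obtain ⟨S, hSW, hSg, hS⟩ := ih (W.erase v) (by rw [card_erase_of_mem hv]; omega)
    refine ⟨S, hSW.trans (erase_subset _ _), hSg, ?_⟩
    rw [card_erase_of_mem hv] at hS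
    have h1 : ∑ u ∈ W.erase v, f u + f v = ∑ u ∈ W, f u := sum_erase_add _ _ hv
    have h2 : #W * f v ≤ ∑ u ∈ W, f u := by
      rw [← smul_eq_mul]
      exact card_nsmul_le_sum _ _ _ hmin
    rcases Nat.eq_zero_or_pos (g + d) with h0 | h0
    · have : g = 0 := by omega
      simp [this]
    · have e1 : #W = g + d + 1 := hW
      rw [e1] at h2 hS ⊢
      simp only [Nat.add_sub_cancel] at hS
      have h3 : (g + d) * ∑ u ∈ W, f u ≤ (g + d + 1) * ∑ u ∈ W.erase v, f u := by
        nlinarith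
      have h4 : (g + d) * (g * ∑ u ∈ W, f u) ≤ (g + d) * ((g + d + 1) * ∑ u ∈ S, f u) := by
        calc _ = g * ((g + d) * ∑ u ∈ W, f u) := by ring
          _ ≤ g * ((g + d + 1) * ∑ u ∈ W.erase v, f u) := Nat.mul_le_mul_left _ h3
          _ = (g + d + 1) * (g * ∑ u ∈ W.erase v, f u) := by ring
          _ ≤ (g + d + 1) * ((g + d) * ∑ u ∈ S, f u) := Nat.mul_le_mul_left _ hS
          _ = _ := by ring
      exact Nat.le_of_mul_le_mul_left h4 h0

/-- A set of vertices spanning more than (roughly) `n^(7/4)` edges yields an induced prism. -/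
theorem prism_of_dense {G : SimpleGraph V} {s ℓ : ℕ} (hs : 1 ≤ s) (hℓ : 2 ≤ ℓ)
    (hG : (completeBipartiteGraph (Fin s) (Fin s)).Free G) {B M : ℕ} (W : Finset V)
    (hB : (2 * ℓ) * (2 * ℓ) * s * (4 * s) ^ ((2 * ℓ) ^ 2) < B)
    (hM : (2 * s) ^ (2 * ℓ) * ((2 * s) ^ (2 * ℓ) * ((2 * ℓ + 2) * s)) ≤ M)
    (hW : 128 * B ^ 3 * M * #W ^ 7 < adjPairs G W ^ 4) :
    (prismGraph (2 * ℓ)).IsIndContained G := by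
  have hB1 : 1 ≤ B := by omega
  have hM1 : 1 ≤ M := le_trans (Nat.mul_pos (by positivity) (Nat.mul_pos (by positivity)
    (by positivity))) hM
  set m := #W with hm
  set E := adjPairs G W with hE
  have hEm : E ≤ m ^ 2 := adjPairs_le_sq G W
  have hE0 : 0 < E := by
    by_contra h
    have : E = 0 := by omega
    rw [this] at hW
    simp at hW
  have hm0 : 0 < m := by
    by_contra h
    have : m = 0 := by omega
    rw [this] at hEm
    omega
  have hmbig : 128 * B ^ 3 * M < m := by
    by_contra h
    have h1 : E ^ 4 ≤ m ^ 8 := (Nat.pow_le_pow_left hEm 4).trans (by rw [← pow_mul])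
    have h2 : m ^ 8 ≤ 128 * B ^ 3 * M * m ^ 7 := by
      rw [pow_succ, mul_comm]
      exact Nat.mul_le_mul_right _ (by omega)
    omega
  have hBm : B < m := by
    have : B ≤ B ^ 3 := Nat.le_self_pow (by norm_num) B
    have h2 : B ^ 3 ≤ B ^ 3 * M := Nat.le_mul_of_pos_right _ hM1
    nlinarith
  -- The least size for which a `g`-subset of average degree sends more than `2mB` to `W`; vertices
  -- with fewer than `B` neighbours in it then account for at most half of the count.
  set g := 2 * m ^ 2 * B / E + 1 with hg
  have hg1 : 2 * m ^ 2 * B < g * E := by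
    rw [hg, mul_comm _ E]
    exact Nat.lt_mul_div_succ _ hE0
  have hg2 : (g - 1) * E ≤ 2 * m ^ 2 * B := by
    rw [hg, Nat.add_sub_cancel]
    exact Nat.div_mul_le_self _ _
  have hg0 : 1 ≤ g := Nat.le_add_left 1 _
  have hg3 : g * E ≤ 3 * m ^ 2 * B := by
    obtain ⟨g', hg'⟩ : ∃ g', g = g' + 1 := ⟨g - 1, by omega⟩
    rw [hg'] at hg2 ⊢
    simp only [Nat.add_sub_cancel] at hg2
    have : m ^ 2 ≤ m ^ 2 * B := Nat.le_mul_of_pos_right _ hB1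
    nlinarith
  have hgm : g ≤ m := by
    by_contra h
    have h1 : m * E ≤ m * (2 * m * B) := by
      calc m * E ≤ (g - 1) * E := Nat.mul_le_mul_right _ (by omega)
        _ ≤ 2 * m ^ 2 * B := hg2
        _ = _ := by ring
    have h2 : E ≤ 2 * m * B := Nat.le_of_mul_le_mul_left h1 hm0
    have h3 : E ^ 4 ≤ (2 * m * B) ^ 4 := Nat.pow_le_pow_left h2 4
    have h4 : (2 * m * B) ^ 4 ≤ 128 * B ^ 3 * M * m ^ 7 := by
      calc (2 * m * B) ^ 4 = 16 * B ^ 3 * m ^ 4 * B := by ring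
        _ ≤ 128 * B ^ 3 * m ^ 4 * (M * m ^ 3) := by
          apply Nat.mul_le_mul (Nat.mul_le_mul_right _ (by omega))
          calc B ≤ m := hBm.le
            _ ≤ m ^ 3 := Nat.le_self_pow (by norm_num) m
            _ ≤ M * m ^ 3 := Nat.le_mul_of_pos_left _ hM1
        _ = _ := by ring
    omega
  obtain ⟨S, hSW, hSg, hS⟩ := exists_subset_card_eq_sum_ge
    (fun v => #{a ∈ W | G.Adj v a}) g (m - g) W (by omega)
  rw [← adjPairs_eq_sum, ← hE, ← hm] at hS
  have hdc : ∑ v ∈ S, #{a ∈ W | G.Adj v a} = ∑ y ∈ W, #{a ∈ S | G.Adj y a} := by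
    simp only [card_filter]
    rw [sum_comm]
    simp only [G.adj_comm]
  set Y : Finset V := {y | B ≤ #{a ∈ S | G.Adj y a}} with hY
  have hupper : ∑ y ∈ W, #{a ∈ S | G.Adj y a} ≤ #Y * g + m * B := by
    calc ∑ y ∈ W, #{a ∈ S | G.Adj y a} ≤ ∑ y ∈ W, ((if y ∈ Y then g else 0) + B) := by
          apply sum_le_sum
          intro y _
          split_ifs with h
          · have : #{a ∈ S | G.Adj y a} ≤ #S := card_filter_le _ _
            omega
          · simp only [hY, mem_filter, mem_univ, true_and, not_le] at h
            omega
      _ ≤ _ := by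
          rw [sum_add_distrib, ← sum_filter, sum_const, sum_const, smul_eq_mul, smul_eq_mul]
          apply Nat.add_le_add_right
          apply Nat.mul_le_mul_right
          exact card_le_card fun y hy => (mem_filter.1 hy).2
  apply prism_of_small_set hs hℓ hG S hB hM
  rw [hSg]
  by_contra hcon
  push Not at hcon
  have h1 : g * E ≤ m * (#Y * g + m * B) := hS.trans (Nat.mul_le_mul_left _ (hdc ▸ hupper))
  have h2 : g * E ≤ g * (2 * m * #Y) := by nlinarith
  have h3 : E ≤ 2 * m * #Y := Nat.le_of_mul_le_mul_left h2 hg0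
  have h4 : E ≤ 2 * m * (g ^ 3 * M) := h3.trans (Nat.mul_le_mul_left _ hcon)
  have h5 : E ^ 4 ≤ 54 * (B ^ 3 * M * m ^ 7) := by
    calc E ^ 4 = E ^ 3 * E := by ring
      _ ≤ E ^ 3 * (2 * m * (g ^ 3 * M)) := Nat.mul_le_mul_left _ h4
      _ = 2 * m * M * (g * E) ^ 3 := by ring
      _ ≤ 2 * m * M * (3 * m ^ 2 * B) ^ 3 := Nat.mul_le_mul_left _ (Nat.pow_le_pow_left hg3 3)
      _ = _ := by ring
  have h6 : 0 < B ^ 3 * M * m ^ 7 := by positivity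
  have h7 : 128 * B ^ 3 * M * m ^ 7 = 128 * (B ^ 3 * M * m ^ 7) := by ring
  omega

/-- The hypothesis bounds the density by `(K / #W)^{1/4}`, which is at most `1 / c` once `#W`
reaches `c ^ 4 * K`. -/
theorem mul_adjPairs_le_sq {V : Type*} {G : SimpleGraph V} {K : ℕ} {W : Finset V}
    (h : adjPairs G W ^ 4 ≤ K * #W ^ 7) (c : ℕ) (hc : c ^ 4 * K ≤ #W) :
    c * adjPairs G W ≤ #W ^ 2 := by
  by_contra hcon
  push Not at hcon
  have h1 := Nat.pow_lt_pow_left hcon (n := 4) (by norm_num)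
  have h2 : (c * adjPairs G W) ^ 4 ≤ #W * #W ^ 7 := by
    calc _ = c ^ 4 * adjPairs G W ^ 4 := by ring
      _ ≤ c ^ 4 * (K * #W ^ 7) := Nat.mul_le_mul_left _ h
      _ = c ^ 4 * K * #W ^ 7 := by ring
      _ ≤ _ := Nat.mul_le_mul_right _ hc
  have h3 : #W * #W ^ 7 = (#W ^ 2) ^ 4 := by ring
  omega

/-- A weighted sum with weights in `[0, c]` and total at most `c w` is at most `c` times a sum over
at most `w` points. -/
theorem exists_card_le_sum_mul_le (f ν : V → ℝ) (hf : ∀ v, 0 ≤ f v) {c : ℝ} (w : ℕ)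
    (hν0 : ∀ v, 0 ≤ ν v) (hνc : ∀ v, ν v ≤ c) (hν : ∑ v, ν v ≤ c * w) :
    ∃ A : Finset V, #A ≤ w ∧ ∑ v, ν v * f v ≤ c * ∑ v ∈ A, f v := by
  rcases le_or_gt (Fintype.card V) w with hw | hw
  · refine ⟨univ, hw, ?_⟩
    rw [mul_sum]
    exact sum_le_sum fun v _ => mul_le_mul_of_nonneg_right (hνc v) (hf v)
  rcases Nat.eq_zero_or_pos w with h0 | h0
  · refine ⟨∅, by simp, ?_⟩
    rw [h0] at hν
    have hz : ∀ v ∈ univ, ν v = 0 := by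
      rw [← sum_eq_zero_iff_of_nonneg fun v _ => hν0 v]
      refine le_antisymm (by simpa using hν) (sum_nonneg fun v _ => hν0 v)
    rw [sum_eq_zero fun v hv => by rw [hz v hv, zero_mul]]
    simp
  · have hne : ((univ : Finset V).powersetCard w).Nonempty :=
      powersetCard_nonempty.2 (by simpa using hw.le)
    -- Fractional knapsack: the best use of the capacity is full weight on the `w` largest values of
    -- `f`.
    obtain ⟨A, hA, hmax⟩ := exists_max_image _ (fun A => ∑ v ∈ A, f v) hne
    rw [mem_powersetCard] at hA
    have hcard := hA.2
    have hAne : A.Nonempty := card_pos.1 (by omega)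
    obtain ⟨a, ha, hmin⟩ := exists_min_image A f hAne
    have hout : ∀ b, b ∉ A → f b ≤ f a := by
      intro b hb
      have hb' : b ∉ A.erase a := fun h => hb (mem_of_mem_erase h)
      have h1 := hmax (insert b (A.erase a)) (by
        rw [mem_powersetCard, card_insert_of_notMem hb', card_erase_of_mem ha]
        exact ⟨subset_univ _, by omega⟩)
      have h2 : ∑ v ∈ A.erase a, f v + f a = ∑ v ∈ A, f v := sum_erase_add _ _ ha
      rw [sum_insert hb'] at h1
      linarith
    refine ⟨A, hcard.le, ?_⟩
    have hsplit : ∀ F : V → ℝ, ∑ v, F v = ∑ v ∈ A, F v + ∑ v ∈ Aᶜ, F v := fun F =>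
      (sum_add_sum_compl A F).symm
    have h1 : ∑ v ∈ Aᶜ, ν v * f v ≤ (∑ v ∈ Aᶜ, ν v) * f a := by
      rw [sum_mul]
      exact sum_le_sum fun v hv => mul_le_mul_of_nonneg_left (hout v (mem_compl.1 hv)) (hν0 v)
    have h2 : (∑ v ∈ Aᶜ, ν v) ≤ ∑ v ∈ A, (c - ν v) := by
      rw [sum_sub_distrib, sum_const, hcard, nsmul_eq_mul]
      have := hsplit ν
      linarith [mul_comm c (w : ℝ)]
    have h3 : (∑ v ∈ A, (c - ν v)) * f a ≤ ∑ v ∈ A, (c - ν v) * f v := by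
      rw [sum_mul]
      exact sum_le_sum fun v hv => mul_le_mul_of_nonneg_left (hmin v hv) (by linarith [hνc v])
    have h4 := mul_le_mul_of_nonneg_right h2 (hf a)
    rw [hsplit]
    have h5 : ∑ v ∈ A, (c - ν v) * f v = c * ∑ v ∈ A, f v - ∑ v ∈ A, ν v * f v := by
      rw [mul_sum, ← sum_sub_distrib]
      exact sum_congr rfl fun v _ => by ring
    linarith

/-- If small sets of vertices are sparse then weights that are not concentrated see few
adjacent pairs. -/
theorem sum_adj_mul_le {G : SimpleGraph V} (w : ℕ) (hw : 1 ≤ w) (η : ℝ)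
    (hsp : ∀ W : Finset V, #W ≤ 2 * w → (adjPairs G W : ℝ) ≤ η * w ^ 2)
    (ν ν' : V → ℝ) (hν : ∀ v, 0 ≤ ν v) (hν' : ∀ v, 0 ≤ ν' v) (h : ℝ)
    (hs : ∑ v, ν v = h) (hs' : ∑ v, ν' v = h) :
    ∑ u, ∑ v, (if G.Adj u v then ν u * ν' v else 0) ≤
      η * h ^ 2 + w * (∑ v, ν v ^ 2 + ∑ v, ν' v ^ 2) := by
  have hw0 : (0 : ℝ) < w := by exact_mod_cast hw
  have hh : 0 ≤ h := hs ▸ sum_nonneg fun v _ => hν v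
  rcases hh.eq_or_lt with h0 | h0
  · have hz : ∀ u ∈ univ, ν u = 0 := by
      rw [← sum_eq_zero_iff_of_nonneg fun v _ => hν v, hs, h0]
    rw [sum_eq_zero fun u hu => sum_eq_zero fun v _ => by simp [hz u hu], ← h0]
    have : 0 ≤ (w : ℝ) * (∑ v, ν v ^ 2 + ∑ v, ν' v ^ 2) := by positivity
    simpa using this
  set c := h / w with hc
  have hc0 : 0 < c := by positivity
  -- Values above `c = h / w` are dropped. There `h ≤ w * μ v`, so the lost mass is controlled by
  -- the second moment; what remains is handled by sets of at most `w` points.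
  have hcut : ∀ μ : V → ℝ, (∀ v, 0 ≤ μ v) → ∃ μ₁ : V → ℝ, (∀ v, 0 ≤ μ₁ v) ∧ (∀ v, μ₁ v ≤ c) ∧
      (∀ v, μ₁ v ≤ μ v) ∧ h * ∑ v, (μ v - μ₁ v) ≤ w * ∑ v, μ v ^ 2 := by
    intro μ hμ
    refine ⟨fun v => if μ v ≤ c then μ v else 0, ?_, ?_, ?_, ?_⟩
    · intro v; dsimp only; split_ifs; exacts [hμ v, le_rfl]
    · intro v; dsimp only; split_ifs with h1; exacts [h1, hc0.le]
    · intro v; dsimp only; split_ifs; exacts [le_rfl, hμ v]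
    · rw [mul_sum, mul_sum]
      refine sum_le_sum fun v _ => ?_
      dsimp only
      split_ifs with h1
      · rw [sub_self, mul_zero]
        positivity
      · push Not at h1
        rw [sub_zero]
        have h2 : h ≤ w * μ v := by
          rw [hc, div_lt_iff₀ hw0] at h1
          linarith
        nlinarith [hμ v]
  obtain ⟨a, ha0, hac, haν, haw⟩ := hcut ν hν
  obtain ⟨b, hb0, hbc, hbν, hbw⟩ := hcut ν' hν'
  have hcw : c * w = h := by rw [hc]; field_simp
  have hasum : ∑ v, a v ≤ c * w := by rw [hcw, ← hs]; exact sum_le_sum fun v _ => haν v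
  have hbsum : ∑ v, b v ≤ c * w := by rw [hcw, ← hs']; exact sum_le_sum fun v _ => hbν v
  have hmain : ∑ u, ∑ v, (if G.Adj u v then a u * b v else 0) ≤ η * h ^ 2 := by
    obtain ⟨A, hA, hA'⟩ := exists_card_le_sum_mul_le
      (fun u => ∑ v, if G.Adj u v then b v else 0) a
      (fun u => sum_nonneg fun v _ => by split_ifs; exacts [hb0 v, le_rfl]) w ha0 hac hasum
    obtain ⟨B, hB, hB'⟩ := exists_card_le_sum_mul_le
      (fun v => ∑ u ∈ A, if G.Adj u v then (1 : ℝ) else 0) b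
      (fun u => sum_nonneg fun v _ => by split_ifs <;> norm_num) w hb0 hbc hbsum
    have hcount : ∑ v ∈ B, ∑ u ∈ A, (if G.Adj u v then (1 : ℝ) else 0) ≤ η * w ^ 2 := by
      refine le_trans ?_ (hsp (A ∪ B) ((card_union_le _ _).trans (by omega)))
      rw [sum_comm, ← sum_product', ← sum_filter, sum_const, nsmul_eq_mul, mul_one]
      exact_mod_cast card_le_card (filter_subset_filter _
        (product_subset_product subset_union_left subset_union_right))
    calc ∑ u, ∑ v, (if G.Adj u v then a u * b v else 0)
        = ∑ u, a u * ∑ v, (if G.Adj u v then b v else 0) := by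
          refine sum_congr rfl fun u _ => ?_
          rw [mul_sum]
          exact sum_congr rfl fun v _ => by split_ifs <;> simp
      _ ≤ c * ∑ u ∈ A, ∑ v, (if G.Adj u v then b v else 0) := hA'
      _ = c * ∑ v, b v * ∑ u ∈ A, (if G.Adj u v then (1 : ℝ) else 0) := by
          rw [sum_comm]
          congr 1
          refine sum_congr rfl fun v _ => ?_
          rw [mul_sum]
          exact sum_congr rfl fun u _ => by split_ifs <;> simp
      _ ≤ c * (c * ∑ v ∈ B, ∑ u ∈ A, (if G.Adj u v then (1 : ℝ) else 0)) :=
          mul_le_mul_of_nonneg_left hB' hc0.le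
      _ ≤ c * (c * (η * w ^ 2)) := by gcongr
      _ = η * (c * w) ^ 2 := by ring
      _ = η * h ^ 2 := by rw [hcw]
  have hpoint : ∀ u v, (if G.Adj u v then ν u * ν' v else 0) ≤
      (if G.Adj u v then a u * b v else 0) + ((ν u - a u) * ν' v + ν u * (ν' v - b v)) := by
    intro u v
    have h1 := haν u
    have h2 := hbν v
    have h3 : 0 ≤ (ν u - a u) * ν' v := mul_nonneg (by linarith) (hν' v)
    have h4 : 0 ≤ ν u * (ν' v - b v) := mul_nonneg (hν u) (by linarith)
    have h5 : 0 ≤ (ν u - a u) * (ν' v - b v) := mul_nonneg (by linarith) (by linarith)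
    split_ifs
    · nlinarith
    · linarith
  calc ∑ u, ∑ v, (if G.Adj u v then ν u * ν' v else 0)
      ≤ ∑ u, ∑ v, ((if G.Adj u v then a u * b v else 0) +
          ((ν u - a u) * ν' v + ν u * (ν' v - b v))) :=
        sum_le_sum fun u _ => sum_le_sum fun v _ => hpoint u v
    _ = ∑ u, ∑ v, (if G.Adj u v then a u * b v else 0) +
          ((∑ u, (ν u - a u)) * ∑ v, ν' v + (∑ u, ν u) * ∑ v, (ν' v - b v)) := by
        simp only [sum_add_distrib, sum_mul_sum]
    _ ≤ _ := by
        rw [hs, hs']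
        linarith

end

/-! ### Closed walk counts and collisions for a symmetric nonnegative matrix -/

section
open scoped Classical
open Finset

variable {V E : Type*} [Fintype V] [Fintype E]

theorem Matrix.IsSymm.pow_apply_comm {A : Matrix E E ℝ} (hA : A.IsSymm) (n : ℕ) (i j : E) :
    (A ^ n) i j = (A ^ n) j i := (hA.pow n).apply j i

/-- The sum of the squares of the entries of `A ^ j`: for symmetric `A`, the weighted number of
closed walks of length `2 j`. -/
noncomputable def closedWalkSum (A : Matrix E E ℝ) (j : ℕ) : ℝ := ∑ e, ∑ f, (A ^ j) e f ^ 2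

theorem sum_pow_mul_pow {A : Matrix E E ℝ} (hA : A.IsSymm) (i j : ℕ) :
    ∑ e, ∑ f, (A ^ i) e f * (A ^ j) e f = ∑ e, (A ^ (i + j)) e e := by
  refine sum_congr rfl fun e _ => ?_
  rw [pow_add, Matrix.mul_apply]
  exact sum_congr rfl fun f _ => by rw [hA.pow_apply_comm j e f]

theorem closedWalkSum_eq {A : Matrix E E ℝ} (hA : A.IsSymm) (j : ℕ) :
    closedWalkSum A j = ∑ e, (A ^ (2 * j)) e e := by
  rw [two_mul, ← sum_pow_mul_pow hA]
  simp only [closedWalkSum, sq]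

theorem closedWalkSum_nonneg (A : Matrix E E ℝ) (j : ℕ) : 0 ≤ closedWalkSum A j := by
  unfold closedWalkSum
  positivity

theorem closedWalkSum_zero (A : Matrix E E ℝ) : closedWalkSum A 0 = Fintype.card E := by
  simp [closedWalkSum, Matrix.one_apply]

/-- Log-convexity: Cauchy–Schwarz for the entrywise inner product of `A ^ j` and `A ^ (j + 2)`. -/
theorem closedWalkSum_sq_le {A : Matrix E E ℝ} (hA : A.IsSymm) (j : ℕ) :
    closedWalkSum A (j + 1) ^ 2 ≤ closedWalkSum A j * closedWalkSum A (j + 2) := by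
  have h : closedWalkSum A (j + 1) = ∑ p : E × E, (A ^ j) p.1 p.2 * (A ^ (j + 2)) p.1 p.2 := by
    rw [closedWalkSum_eq hA, Fintype.sum_prod_type, sum_pow_mul_pow hA,
      show 2 * (j + 1) = j + (j + 2) by ring]
  rw [h]
  refine (sum_mul_sq_le_sq_mul_sq _ _ _).trans_eq ?_
  simp only [closedWalkSum, Fintype.sum_prod_type]

/-- The ratios of consecutive terms increase by log-convexity, so the last one is at least the
geometric mean of all those starting from the value `Fintype.card E` at `0`. -/
theorem closedWalkSum_pow_le {A : Matrix E E ℝ} (hA : A.IsSymm)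
    (hpos : ∀ j, 0 < closedWalkSum A j) (k : ℕ) :
    closedWalkSum A k ^ (k + 1) ≤ Fintype.card E * closedWalkSum A (k + 1) ^ k := by
  induction k with
  | zero => simp [closedWalkSum_zero]
  | succ k ih =>
    have h := closedWalkSum_sq_le hA k
    have p0 := hpos k
    have p1 := hpos (k + 1)
    have p2 := hpos (k + 2)
    have h1 : closedWalkSum A (k + 1) ^ k * closedWalkSum A (k + 1) ^ (k + 2) ≤
        closedWalkSum A (k + 1) ^ k * (Fintype.card E * closedWalkSum A (k + 2) ^ (k + 1)) := by
      calc _ = (closedWalkSum A (k + 1) ^ 2) ^ (k + 1) := by ring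
        _ ≤ (closedWalkSum A k * closedWalkSum A (k + 2)) ^ (k + 1) := by gcongr
        _ = closedWalkSum A k ^ (k + 1) * closedWalkSum A (k + 2) ^ (k + 1) := by ring
        _ ≤ (Fintype.card E * closedWalkSum A (k + 1) ^ k) * closedWalkSum A (k + 2) ^ (k + 1) := by
          gcongr
        _ = _ := by ring
    exact le_of_mul_le_mul_left h1 (by positivity)

/-- The closed walk count is at least what the average row sum predicts. -/
theorem pow_le_closedWalkSum {A : Matrix E E ℝ} (hA : A.IsSymm) [Nonempty E] {d : ℝ} (hd : 0 < d)
    (hsum : Fintype.card E * d ≤ ∑ e, ∑ f, A e f) (j : ℕ) : d ^ (2 * j) ≤ closedWalkSum A j := by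
  set N : ℝ := (Fintype.card E : ℝ) with hN
  have hN0 : 0 < N := by simp [hN, Fintype.card_pos]
  set r : ℕ → E → ℝ := fun j e => ∑ f, (A ^ j) e f with hr
  -- With `1` the all-ones vector, `c j` is `1ᵀ A^{2j} 1`. It is log-convex with first ratio at
  -- least `d ^ 2`, and a further Cauchy–Schwarz compares it with the trace.
  set c : ℕ → ℝ := fun j => ∑ e, r j e ^ 2 with hc
  have hrr : ∀ i j, ∑ e, r i e * r j e = ∑ f, ∑ g, (A ^ (i + j)) f g := by
    intro i j
    simp only [hr, sum_mul_sum]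
    rw [sum_comm]
    refine sum_congr rfl fun f _ => ?_
    rw [sum_comm]
    refine sum_congr rfl fun g _ => ?_
    rw [pow_add, Matrix.mul_apply]
    exact sum_congr rfl fun e _ => by rw [hA.pow_apply_comm i e f]
  have hc0 : c 0 = N := by simp [hc, hr, hN, Matrix.one_apply]
  have hc1 : d ^ 2 * N ≤ c 1 := by
    have h1 : (∑ e, r 1 e) ^ 2 ≤ N * c 1 := by
      have := sq_sum_le_card_mul_sum_sq (s := (univ : Finset E)) (f := r 1)
      simpa [hN, hc] using this
    have h2 : N * d ≤ ∑ e, r 1 e := by simpa [hr] using hsum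
    have h3 : (N * d) ^ 2 ≤ N * c 1 := (pow_le_pow_left₀ (by positivity) h2 2).trans h1
    have h4 : N * (d ^ 2 * N) ≤ N * c 1 := by linarith [h3]
    exact le_of_mul_le_mul_left h4 hN0
  have hconv : ∀ j, c (j + 1) ^ 2 ≤ c j * c (j + 2) := by
    intro j
    have h1 : c (j + 1) = ∑ e, r j e * r (j + 2) e := by
      have : c (j + 1) = ∑ e, r (j + 1) e * r (j + 1) e := by simp only [hc, sq]
      rw [this, hrr, hrr, show j + 1 + (j + 1) = j + (j + 2) by ring]
    rw [h1]
    exact sum_mul_sq_le_sq_mul_sq _ _ _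
  have hstep : ∀ j, 0 < c j ∧ d ^ 2 * c j ≤ c (j + 1) := by
    intro j
    induction j with
    | zero => rw [hc0]; exact ⟨hN0, hc1⟩
    | succ j ih =>
      have p1 : 0 < c (j + 1) := lt_of_lt_of_le (mul_pos (by positivity) ih.1) ih.2
      refine ⟨p1, ?_⟩
      have h1 : c j * (d ^ 2 * c (j + 1)) ≤ c j * c (j + 2) := by
        calc _ = (d ^ 2 * c j) * c (j + 1) := by ring
          _ ≤ c (j + 1) * c (j + 1) := by gcongr; exact ih.2
          _ = c (j + 1) ^ 2 := by ring
          _ ≤ _ := hconv j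
      exact le_of_mul_le_mul_left h1 ih.1
  have hcj : ∀ j, N * d ^ (2 * j) ≤ c j := by
    intro j
    induction j with
    | zero => simp [hc0]
    | succ j ih =>
      calc N * d ^ (2 * (j + 1)) = d ^ 2 * (N * d ^ (2 * j)) := by ring
        _ ≤ d ^ 2 * c j := by gcongr
        _ ≤ _ := (hstep j).2
  have hca : c j ≤ N * closedWalkSum A j := by
    simp only [hc, closedWalkSum, mul_sum (f := fun e => ∑ f, (A ^ j) e f ^ 2)]
    refine sum_le_sum fun e _ => ?_
    have := sq_sum_le_card_mul_sum_sq (s := (univ : Finset E)) (f := fun f => (A ^ j) e f)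
    simpa [hN] using this
  exact le_of_mul_le_mul_left ((hcj j).trans hca) hN0

/-- The weight of pairs of walks with common ends whose vertices after `p` steps have the same
image under `α`. -/
noncomputable def collisionSum (A : Matrix E E ℝ) (α : E → V) (p q : ℕ) : ℝ :=
  ∑ e, ∑ f, ∑ v, (∑ u, if α u = v then (A ^ p) e u * (A ^ q) u f else 0) ^ 2

/-- Two walks with common ends glue to a closed walk, which the colliding vertices cut into arcs of
lengths `2p` and `2q`. -/
theorem collisionSum_eq {A : Matrix E E ℝ} (hA : A.IsSymm) (α : E → V) (p q : ℕ) :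
    collisionSum A α p q =
      ∑ u, ∑ u', if α u = α u' then (A ^ (2 * p)) u u' * (A ^ (2 * q)) u u' else 0 := by
  have h1 : ∀ e f, ∑ v, (∑ u, if α u = v then (A ^ p) e u * (A ^ q) u f else 0) ^ 2 =
      ∑ u, ∑ u', if α u = α u' then
        ((A ^ p) u e * (A ^ p) e u') * ((A ^ q) u f * (A ^ q) f u') else 0 := by
    intro e f
    simp only [sq, sum_mul_sum]
    rw [sum_comm]
    refine sum_congr rfl fun u _ => ?_
    rw [sum_comm]
    refine sum_congr rfl fun u' _ => ?_
    rw [sum_eq_single (α u)]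
    · rw [if_pos rfl]
      by_cases h : α u = α u'
      · rw [if_pos h.symm, if_pos h, hA.pow_apply_comm p u e, hA.pow_apply_comm q f u']
        ring
      · rw [if_neg (fun h' => h h'.symm), if_neg h, mul_zero]
    · intro v _ hv
      rw [if_neg (fun h => hv h.symm), zero_mul]
    · simp
  simp only [collisionSum, h1]
  calc _ = ∑ e, ∑ u, ∑ u', ∑ f, (if α u = α u' then
        ((A ^ p) u e * (A ^ p) e u') * ((A ^ q) u f * (A ^ q) f u') else 0) := by
        refine sum_congr rfl fun e _ => ?_
        rw [sum_comm]
        exact sum_congr rfl fun u _ => sum_comm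
    _ = ∑ u, ∑ u', ∑ e, ∑ f, (if α u = α u' then
        ((A ^ p) u e * (A ^ p) e u') * ((A ^ q) u f * (A ^ q) f u') else 0) := by
        rw [sum_comm]
        exact sum_congr rfl fun u _ => sum_comm
    _ = _ := by
        refine sum_congr rfl fun u _ => sum_congr rfl fun u' _ => ?_
        split_ifs with h
        · rw [two_mul, two_mul, pow_add, pow_add, Matrix.mul_apply, Matrix.mul_apply, sum_mul_sum]
        · simp

/-- Collisions are rare if the rows of `A` are not concentrated on a fibre of `α`. -/
theorem collisionSum_sq_le {A : Matrix E E ℝ} (hA : A.IsSymm) (h0 : ∀ i j, 0 ≤ A i j) (α : E → V)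
    {t Δ : ℝ} (ht : 0 ≤ t) (htA : ∀ z v, ∑ u, (if α u = v then A z u else 0) ≤ t)
    (hΔ : ∀ z, ∑ u, A z u ≤ Δ) {p q k : ℕ} (hp : 1 ≤ p) (hq : 1 ≤ q) (hk : p + q = k + 1) :
    collisionSum A α p q ^ 2 ≤ t * Δ * closedWalkSum A k * closedWalkSum A (k + 1) := by
  -- This ensures `2 * p ≤ k + 1`, so that the truncated subtraction `k + 1 - 2 * p` below is
  -- genuine.
  wlog hpq : p ≤ q generalizing p q
  · have h1 := this hq hp (by omega) (by omega)
    have h2 : collisionSum A α p q = collisionSum A α q p := by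
      rw [collisionSum_eq hA, collisionSum_eq hA]
      simp only [mul_comm]
    rwa [h2]
  have hnn := Matrix.pow_apply_nonneg h0
  -- The closed walk of length `2k + 2` is cut as one step `z₀ → z₁`, then `k` steps to `z` passing
  -- through the partner `u` of `z₀`, then `k + 1` steps back. Cauchy–Schwarz separates the last two
  -- pieces. In the square of the first, one copy of `b` is relaxed to `A ^ k`, and the sum over
  -- `z₀` is then a step from `z₁` into a prescribed fibre, which costs `t`.
  set b : E → E → E → ℝ := fun z₀ z₁ z =>
    ∑ u, if α z₀ = α u then (A ^ (2 * p - 1)) z₁ u * (A ^ (k + 1 - 2 * p)) u z else 0 with hb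
  have hb0 : ∀ z₀ z₁ z, 0 ≤ b z₀ z₁ z := by
    intro z₀ z₁ z
    refine sum_nonneg fun u _ => ?_
    split_ifs
    exacts [mul_nonneg (hnn _ _ _) (hnn _ _ _), le_rfl]
  have hble : ∀ z₀ z₁ z, b z₀ z₁ z ≤ (A ^ k) z₁ z := by
    intro z₀ z₁ z
    rw [show k = (2 * p - 1) + (k + 1 - 2 * p) by omega, pow_add, Matrix.mul_apply]
    refine sum_le_sum fun u _ => ?_
    split_ifs
    exacts [le_rfl, mul_nonneg (hnn _ _ _) (hnn _ _ _)]
  have hX : collisionSum A α p q =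
      ∑ x : E × E × E, A x.1 x.2.1 * b x.1 x.2.1 x.2.2 * (A ^ (k + 1)) x.2.2 x.1 := by
    rw [collisionSum_eq hA]
    simp only [Fintype.sum_prod_type]
    refine sum_congr rfl fun z₀ _ => ?_
    simp only [hb, mul_sum, sum_mul]
    calc _ = ∑ u, ∑ z₁, ∑ z, A z₀ z₁ * (if α z₀ = α u then
            (A ^ (2 * p - 1)) z₁ u * (A ^ (k + 1 - 2 * p)) u z else 0) * (A ^ (k + 1)) z z₀ := by
          refine sum_congr rfl fun u _ => ?_
          split_ifs with h
          · rw [hA.pow_apply_comm (2 * q), show 2 * p = 1 + (2 * p - 1) by omega,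
              show 2 * q = (k + 1 - 2 * p) + (k + 1) by omega, pow_add, pow_add (m := k + 1 - 2 * p),
              Matrix.mul_apply, Matrix.mul_apply, sum_mul_sum]
            refine sum_congr rfl fun z₁ _ => sum_congr rfl fun z _ => ?_
            rw [← show 2 * p = 1 + (2 * p - 1) by omega, pow_one]
            ring
          · simp
      _ = _ := by
          rw [sum_comm]
          exact sum_congr rfl fun z₁ _ => sum_comm
  have h1 : ∑ x : E × E × E, A x.1 x.2.1 * b x.1 x.2.1 x.2.2 ^ 2 ≤ t * closedWalkSum A k := by
    simp only [Fintype.sum_prod_type]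
    calc _ ≤ ∑ z₀, ∑ z₁, ∑ z, A z₀ z₁ * (b z₀ z₁ z * (A ^ k) z₁ z) := by
          refine sum_le_sum fun z₀ _ => sum_le_sum fun z₁ _ => sum_le_sum fun z _ => ?_
          refine mul_le_mul_of_nonneg_left ?_ (h0 _ _)
          rw [sq]
          exact mul_le_mul_of_nonneg_left (hble _ _ _) (hb0 _ _ _)
      _ = ∑ z₁, ∑ z, (A ^ k) z₁ z * ∑ z₀, A z₀ z₁ * b z₀ z₁ z := by
          rw [sum_comm]
          refine sum_congr rfl fun z₁ _ => ?_
          rw [sum_comm]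
          refine sum_congr rfl fun z _ => ?_
          rw [mul_sum]
          exact sum_congr rfl fun z₀ _ => by ring
      _ ≤ ∑ z₁, ∑ z, (A ^ k) z₁ z * (t * (A ^ k) z₁ z) := by
          refine sum_le_sum fun z₁ _ => sum_le_sum fun z _ => ?_
          refine mul_le_mul_of_nonneg_left ?_ (hnn _ _ _)
          simp only [hb, mul_sum]
          rw [sum_comm, show k = (2 * p - 1) + (k + 1 - 2 * p) by omega, pow_add,
            Matrix.mul_apply, mul_sum, ← show k = (2 * p - 1) + (k + 1 - 2 * p) by omega]
          refine sum_le_sum fun u _ => ?_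
          calc _ = (∑ z₀, if α z₀ = α u then A z₁ z₀ else 0) *
                ((A ^ (2 * p - 1)) z₁ u * (A ^ (k + 1 - 2 * p)) u z) := by
                rw [sum_mul]
                refine sum_congr rfl fun z₀ _ => ?_
                rw [hA.apply z₁ z₀]
                split_ifs <;> simp
            _ ≤ _ := mul_le_mul_of_nonneg_right (htA _ _) (mul_nonneg (hnn _ _ _) (hnn _ _ _))
      _ = t * closedWalkSum A k := by
          simp only [closedWalkSum, mul_sum]
          exact sum_congr rfl fun z₁ _ => sum_congr rfl fun z _ => by ring
  have h2 : ∑ x : E × E × E, A x.1 x.2.1 * (A ^ (k + 1)) x.2.2 x.1 ^ 2 ≤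
      Δ * closedWalkSum A (k + 1) := by
    simp only [Fintype.sum_prod_type]
    calc _ = ∑ z₀, (∑ z₁, A z₀ z₁) * ∑ z, (A ^ (k + 1)) z z₀ ^ 2 := by
          refine sum_congr rfl fun z₀ _ => ?_
          rw [sum_mul_sum]
      _ ≤ ∑ z₀, Δ * ∑ z, (A ^ (k + 1)) z z₀ ^ 2 :=
          sum_le_sum fun z₀ _ => mul_le_mul_of_nonneg_right (hΔ z₀) (by positivity)
      _ = _ := by
          rw [closedWalkSum, sum_comm, mul_sum]
  rw [hX]
  have hcs := sum_sq_le_sum_mul_sum_of_sq_le_mul (univ : Finset (E × E × E))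
    (f := fun x => A x.1 x.2.1 * b x.1 x.2.1 x.2.2 ^ 2)
    (g := fun x => A x.1 x.2.1 * (A ^ (k + 1)) x.2.2 x.1 ^ 2)
    (r := fun x => A x.1 x.2.1 * b x.1 x.2.1 x.2.2 * (A ^ (k + 1)) x.2.2 x.1)
    (fun x _ => mul_nonneg (h0 _ _) (sq_nonneg _)) (fun x _ => mul_nonneg (h0 _ _) (sq_nonneg _))
    (fun x _ => le_of_eq (by ring))
  refine hcs.trans ?_
  calc _ ≤ (t * closedWalkSum A k) * (Δ * closedWalkSum A (k + 1)) :=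
        mul_le_mul h1 h2 (sum_nonneg fun x _ => mul_nonneg (h0 _ _) (sq_nonneg _))
          (mul_nonneg ht (closedWalkSum_nonneg _ _))
    _ = _ := by ring

end

/-! ### Conflicts between two positions of a closed walk, and the union bound -/

section
open scoped Classical
open Finset

variable {V E : Type*} [Fintype V] [Fintype E]

/-- Two vertices of a weighted closed walk are rarely mapped to adjacent vertices. -/
theorem sum_adj_pow_mul_pow_le {G : SimpleGraph V} {A : Matrix E E ℝ} (hA : A.IsSymm)
    (h0 : ∀ i j, 0 ≤ A i j) (w : ℕ) (hw : 1 ≤ w) (η : ℝ)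
    (hsp : ∀ W : Finset V, #W ≤ 2 * w → (adjPairs G W : ℝ) ≤ η * w ^ 2)
    (α β : E → V) {k r : ℕ} (hr : 2 ≤ r) (hrk : r ≤ k) :
    ∑ u, ∑ u', (if G.Adj (α u) (β u') then (A ^ r) u u' * (A ^ (2 * k - r)) u u' else 0) ≤
      η * closedWalkSum A k +
        w * (collisionSum A α 1 (k - 1) + collisionSum A β (r - 1) (k + 1 - r)) := by
  have hnn := Matrix.pow_apply_nonneg h0
  -- The opposite points `e`, `f` are placed so that `e` is one step from `u` towards `u'`. Then `u`
  -- and `u'` lie on different halves and are independent given `e` and `f`; `r ≥ 2` keeps `u'` away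
  -- from `e`.
  set ν : E → E → V → ℝ := fun e f v =>
    ∑ u, if α u = v then (A ^ 1) e u * (A ^ (k - 1)) u f else 0 with hν
  set ν' : E → E → V → ℝ := fun e f v =>
    ∑ u, if β u = v then (A ^ (r - 1)) e u * (A ^ (k + 1 - r)) u f else 0 with hν'
  have hnon : ∀ (p q : ℕ) (γ : E → V) (e f : E) (v : V),
      0 ≤ ∑ u, if γ u = v then (A ^ p) e u * (A ^ q) u f else 0 := by
    intro p q γ e f v
    refine sum_nonneg fun u _ => ?_
    split_ifs
    exacts [mul_nonneg (hnn _ _ _) (hnn _ _ _), le_rfl]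
  have htot : ∀ (p q : ℕ) (γ : E → V) (e f : E), p + q = k →
      ∑ v, ∑ u, (if γ u = v then (A ^ p) e u * (A ^ q) u f else 0) = (A ^ k) e f := by
    intro p q γ e f hpq
    rw [← hpq, pow_add, Matrix.mul_apply, sum_comm]
    exact sum_congr rfl fun u _ => by simp
  have hkey : ∀ e f, ∑ u, ∑ u', (if G.Adj (α u) (β u') then
      ((A ^ 1) e u * (A ^ (k - 1)) u f) * ((A ^ (r - 1)) e u' * (A ^ (k + 1 - r)) u' f) else 0) ≤
      η * (A ^ k) e f ^ 2 + w * (∑ v, ν e f v ^ 2 + ∑ v, ν' e f v ^ 2) := by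
    intro e f
    have h := sum_adj_mul_le (G := G) w hw η hsp (ν e f) (ν' e f) (fun v => hnon _ _ _ _ _ _)
      (fun v => hnon _ _ _ _ _ _) ((A ^ k) e f) (htot _ _ _ _ _ (by omega))
      (htot _ _ _ _ _ (by omega))
    refine le_trans (le_of_eq ?_) h
    have h1 : ∀ v v', (if G.Adj v v' then ν e f v * ν' e f v' else 0) =
        ∑ u, ∑ u', if α u = v then (if β u' = v' then (if G.Adj v v' then
          ((A ^ 1) e u * (A ^ (k - 1)) u f) * ((A ^ (r - 1)) e u' * (A ^ (k + 1 - r)) u' f)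
            else 0) else 0) else 0 := by
      intro v v'
      split_ifs with hadj
      · simp only [hν, hν', sum_mul_sum]
        refine sum_congr rfl fun u _ => sum_congr rfl fun u' _ => ?_
        split_ifs <;> simp
      · simp
    simp only [h1]
    symm
    calc _ = ∑ v, ∑ u, ∑ u', ∑ v', (if α u = v then (if β u' = v' then (if G.Adj v v' then
          ((A ^ 1) e u * (A ^ (k - 1)) u f) * ((A ^ (r - 1)) e u' * (A ^ (k + 1 - r)) u' f)
            else 0) else 0) else 0) := by
          refine sum_congr rfl fun v _ => ?_
          rw [sum_comm]
          exact sum_congr rfl fun u _ => sum_comm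
      _ = ∑ u, ∑ u', ∑ v, ∑ v', (if α u = v then (if β u' = v' then (if G.Adj v v' then
          ((A ^ 1) e u * (A ^ (k - 1)) u f) * ((A ^ (r - 1)) e u' * (A ^ (k + 1 - r)) u' f)
            else 0) else 0) else 0) := by
          rw [sum_comm]
          exact sum_congr rfl fun u _ => sum_comm
      _ = _ := by
          refine sum_congr rfl fun u _ => sum_congr rfl fun u' _ => ?_
          rw [sum_eq_single (α u) (fun v _ hv => sum_eq_zero fun v' _ => if_neg (Ne.symm hv))
            (by simp), sum_eq_single (β u') (fun v _ hv => by rw [if_pos rfl, if_neg (Ne.symm hv)])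
            (by simp), if_pos rfl, if_pos rfl]
  have hlhs : ∑ u, ∑ u', (if G.Adj (α u) (β u') then (A ^ r) u u' * (A ^ (2 * k - r)) u u' else 0)
      = ∑ e, ∑ f, ∑ u, ∑ u', (if G.Adj (α u) (β u') then
      ((A ^ 1) e u * (A ^ (k - 1)) u f) * ((A ^ (r - 1)) e u' * (A ^ (k + 1 - r)) u' f) else 0) := by
    calc _ = ∑ u, ∑ u', ∑ e, ∑ f, (if G.Adj (α u) (β u') then
      ((A ^ 1) e u * (A ^ (k - 1)) u f) * ((A ^ (r - 1)) e u' * (A ^ (k + 1 - r)) u' f)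
        else 0) := by
          refine sum_congr rfl fun u _ => sum_congr rfl fun u' _ => ?_
          split_ifs
          · have e1 : (A ^ r) u u' = ∑ e, (A ^ 1) e u * (A ^ (r - 1)) e u' := by
              rw [show r = 1 + (r - 1) by omega, pow_add, Matrix.mul_apply,
                ← show r = 1 + (r - 1) by omega]
              exact sum_congr rfl fun e _ => by rw [hA.pow_apply_comm 1 u e]
            have e2 : (A ^ (2 * k - r)) u u' =
                ∑ f, (A ^ (k - 1)) u f * (A ^ (k + 1 - r)) u' f := by
              rw [show 2 * k - r = (k - 1) + (k + 1 - r) by omega, pow_add, Matrix.mul_apply]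
              exact sum_congr rfl fun f _ => by rw [hA.pow_apply_comm _ f u']
            rw [e1, e2, sum_mul_sum]
            exact sum_congr rfl fun e _ => sum_congr rfl fun f _ => by ring
          · simp
      _ = ∑ u, ∑ e, ∑ f, ∑ u', (if G.Adj (α u) (β u') then
      ((A ^ 1) e u * (A ^ (k - 1)) u f) * ((A ^ (r - 1)) e u' * (A ^ (k + 1 - r)) u' f)
        else 0) := by
          refine sum_congr rfl fun u _ => ?_
          rw [sum_comm]
          exact sum_congr rfl fun e _ => sum_comm
      _ = _ := by
          rw [sum_comm]
          exact sum_congr rfl fun e _ => sum_comm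
  rw [hlhs]
  refine (sum_le_sum fun e _ => sum_le_sum fun f _ => hkey e f).trans (le_of_eq ?_)
  simp only [sum_add_distrib, ← mul_sum, closedWalkSum, collisionSum, hν, hν']

/-- The weight of a walk. -/
noncomputable def walkWeight (A : Matrix E E ℝ) {m : ℕ} (z : Fin (m + 1) → E) : ℝ :=
  ∏ i : Fin m, A (z i.castSucc) (z i.succ)

/-- Keeping both ends and two marked positions is just enough to close the walk up and to test one
pair for a conflict. -/
theorem sum_walkWeight_mul (A : Matrix E E ℝ) : ∀ (m i j : ℕ) (hij : i ≤ j) (hj : j ≤ m)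
    (F : E → E → E → E → ℝ),
    ∑ z : Fin (m + 1) → E, walkWeight A z * F (z 0) (z ⟨i, by omega⟩) (z ⟨j, by omega⟩)
      (z (Fin.last m)) =
    ∑ a, ∑ b, ∑ c, ∑ d, (A ^ i) a b * (A ^ (j - i)) b c * (A ^ (m - j)) c d * F a b c d := by
  intro m
  induction m with
  | zero =>
    intro i j hij hj F
    obtain rfl : j = 0 := by omega
    obtain rfl : i = 0 := by omega
    rw [← (Equiv.funUnique (Fin 1) E).symm.sum_comp]
    simp [walkWeight, Matrix.one_apply, ite_mul]
  | succ m ih =>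
    intro i j hij hj F
    rw [← (Fin.snocEquiv (fun _ : Fin (m + 2) => E)).sum_comp, Fintype.sum_prod_type, sum_comm]
    have hw : ∀ (z : Fin (m + 1) → E) (d : E),
        walkWeight A (Fin.snoc z d : Fin (m + 2) → E) = walkWeight A z * A (z (Fin.last m)) d := by
      intro z d
      rw [walkWeight, Fin.prod_univ_castSucc, walkWeight]
      congr 1
      · refine prod_congr rfl fun l _ => ?_
        rw [Fin.snoc_castSucc, ← Fin.castSucc_succ, Fin.snoc_castSucc]
      · rw [Fin.snoc_castSucc, Fin.succ_last, Fin.snoc_last]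
    have hval : ∀ (z : Fin (m + 1) → E) (d : E) (l : ℕ) (hl : l ≤ m),
        (Fin.snoc z d : Fin (m + 2) → E) ⟨l, by omega⟩ = z ⟨l, by omega⟩ := by
      intro z d l hl
      exact Fin.snoc_castSucc (α := fun _ => E) d z ⟨l, by omega⟩
    have hlast : ∀ (z : Fin (m + 1) → E) (d : E) (h : m + 1 < m + 2),
        (Fin.snoc z d : Fin (m + 2) → E) ⟨m + 1, h⟩ = d := by
      intro z d h
      exact Fin.snoc_last (α := fun _ => E) d z
    have hpow : ∀ (n : ℕ) (c d : E), (A ^ (n + 1)) c d = ∑ e, (A ^ n) c e * A e d := by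
      intro n c d
      rw [pow_succ, Matrix.mul_apply]
    have hzero : ∀ (z : Fin (m + 1) → E) (d : E), (Fin.snoc z d : Fin (m + 2) → E) 0 = z 0 :=
      fun z d => hval z d 0 (by omega)
    simp only [Fin.snocEquiv, Equiv.coe_fn_mk, hw, hzero]
    by_cases hjm : j ≤ m
    · have h := ih i j hij hjm (fun a b c e => ∑ d, A e d * F a b c d)
      simp only [hval _ _ j hjm, hval _ _ i (hij.trans hjm), Fin.snoc_last]
      calc _ = _ := by
            refine sum_congr rfl fun z _ => ?_
            rw [mul_sum]
            exact sum_congr rfl fun d _ => mul_assoc _ _ _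
        _ = _ := h
        _ = _ := by
            refine sum_congr rfl fun a _ => sum_congr rfl fun b _ => sum_congr rfl fun c _ => ?_
            simp only [show m + 1 - j = (m - j) + 1 by omega, hpow, mul_sum, sum_mul]
            rw [sum_comm]
            exact sum_congr rfl fun d _ => sum_congr rfl fun e _ => by ring
    · obtain rfl : j = m + 1 := by omega
      have hone : ∀ (H : E → E → ℝ), ∑ c, ∑ d, H c d * (A ^ 0) c d = ∑ d, H d d := by
        intro H
        simp [Matrix.one_apply]
      by_cases him : i ≤ m
      · have h := ih i m him le_rfl (fun a b _ e => ∑ d, A e d * F a b d d)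
        simp only [hlast, hval _ _ i him, Fin.snoc_last]
        calc _ = _ := by
              refine sum_congr rfl fun z _ => ?_
              rw [mul_sum]
              exact sum_congr rfl fun d _ => mul_assoc _ _ _
          _ = _ := h
          _ = _ := by
              refine sum_congr rfl fun a _ => sum_congr rfl fun b _ => ?_
              simp only [Nat.sub_self, pow_zero, Matrix.one_apply, mul_ite, ite_mul, mul_one,
                mul_zero, zero_mul, sum_ite_eq, mem_univ, if_true]
              simp only [show m + 1 - i = (m - i) + 1 by omega, hpow, mul_sum, sum_mul]
              rw [sum_comm]
              exact sum_congr rfl fun d _ => sum_congr rfl fun e _ => by ring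
      · obtain rfl : i = m + 1 := by omega
        have h := ih m m le_rfl le_rfl (fun a _ _ e => ∑ d, A e d * F a d d d)
        simp only [hlast, Fin.snoc_last]
        calc _ = _ := by
              refine sum_congr rfl fun z _ => ?_
              rw [mul_sum]
              exact sum_congr rfl fun d _ => mul_assoc _ _ _
          _ = _ := h
          _ = _ := by
              refine sum_congr rfl fun a _ => ?_
              simp only [Nat.sub_self, pow_zero, Matrix.one_apply, mul_ite, ite_mul, mul_one,
                mul_zero, zero_mul, sum_ite_eq, mem_univ, if_true]
              simp only [hpow, mul_sum, sum_mul]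
              rw [sum_comm]
              exact sum_congr rfl fun d _ => sum_congr rfl fun e _ => by ring

/-- If the conflicts between any two positions are rare, then some closed walk has no
conflicts. -/
theorem exists_closed_walk {A : Matrix E E ℝ} (hA : A.IsSymm) (h0 : ∀ i j, 0 ≤ A i j)
    (k : ℕ) (conf : E → E → Prop)
    (hconf : ∀ r, 2 ≤ r → r + 2 ≤ 2 * k →
      (2 * k) ^ 2 * ∑ b, ∑ c, (if conf b c then (A ^ r) b c * (A ^ (2 * k - r)) b c else 0) <
        closedWalkSum A k) (hpos : 0 < closedWalkSum A k) :
    ∃ z : Fin (2 * k + 1) → E, z 0 = z (Fin.last _) ∧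
      (∀ i : Fin (2 * k), A (z i.castSucc) (z i.succ) ≠ 0) ∧
      ∀ i j : Fin (2 * k), i.val + 2 ≤ j.val → j.val + 2 ≤ i.val + 2 * k →
        ¬ conf (z i.castSucc) (z j.castSucc) := by
  by_contra hcon
  push Not at hcon
  set P : Finset (Fin (2 * k) × Fin (2 * k)) :=
    {p | p.1.val + 2 ≤ p.2.val ∧ p.2.val + 2 ≤ p.1.val + 2 * k} with hP
  have hww : ∀ z : Fin (2 * k + 1) → E, 0 ≤ walkWeight A z := fun z =>
    prod_nonneg fun i _ => h0 _ _
  have htotal : ∑ z : Fin (2 * k + 1) → E,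
      walkWeight A z * (if z 0 = z (Fin.last _) then 1 else 0) = closedWalkSum A k := by
    have h := sum_walkWeight_mul A (2 * k) 0 0 le_rfl (Nat.zero_le _)
      (fun a _ _ d => if a = d then 1 else 0)
    rw [h, closedWalkSum_eq hA]
    simp [Matrix.one_apply]
  have hpair : ∀ p ∈ P, ∑ z : Fin (2 * k + 1) → E, walkWeight A z *
      (if z 0 = z (Fin.last _) ∧ conf (z p.1.castSucc) (z p.2.castSucc) then 1 else 0) =
      ∑ b, ∑ c, (if conf b c then (A ^ (p.2.val - p.1.val)) b c *
        (A ^ (2 * k - (p.2.val - p.1.val))) b c else 0) := by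
    rintro ⟨i, j⟩ hp
    simp only [hP, mem_filter, mem_univ, true_and] at hp
    have hjl := j.isLt
    have h := sum_walkWeight_mul A (2 * k) i.val j.val (by omega) (by omega)
      (fun a b c d => if a = d ∧ conf b c then 1 else 0)
    refine Eq.trans h ?_
    rw [sum_comm]
    refine sum_congr rfl fun b _ => ?_
    rw [sum_comm]
    refine sum_congr rfl fun c _ => ?_
    by_cases hbc : conf b c
    · simp only [hbc, and_true, if_true, mul_ite, mul_one, mul_zero, sum_ite_eq, mem_univ]
      rw [show 2 * k - (j.val - i.val) = (2 * k - j.val) + i.val by omega,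
        hA.pow_apply_comm (2 * k - j.val + i.val), pow_add, Matrix.mul_apply, mul_sum]
      exact sum_congr rfl fun a _ => by ring
    · simp [hbc]
  -- By assumption each closed walk of nonzero weight has a conflicting pair, so it is counted at
  -- least once on the right.
  have hle : closedWalkSum A k ≤ ∑ p ∈ P, ∑ z : Fin (2 * k + 1) → E, walkWeight A z *
      (if z 0 = z (Fin.last _) ∧ conf (z p.1.castSucc) (z p.2.castSucc) then 1 else 0) := by
    rw [← htotal, sum_comm]
    refine sum_le_sum fun z _ => ?_
    rw [← mul_sum]
    by_cases hz : z 0 = z (Fin.last _)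
    · by_cases hW : walkWeight A z = 0
      · rw [hW, zero_mul, zero_mul]
      · have hne : ∀ i : Fin (2 * k), A (z i.castSucc) (z i.succ) ≠ 0 := by
          intro i hi
          exact hW (prod_eq_zero (mem_univ i) hi)
        obtain ⟨i, j, h1, h2, h3⟩ := hcon z hz hne
        refine mul_le_mul_of_nonneg_left ?_ (hww z)
        rw [if_pos hz]
        have h4 := single_le_sum (f := fun p : Fin (2 * k) × Fin (2 * k) =>
          if z 0 = z (Fin.last _) ∧ conf (z p.1.castSucc) (z p.2.castSucc) then (1 : ℝ) else 0)
          (s := P) (fun p _ => by split_ifs <;> norm_num) (a := (i, j))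
          (by simp only [hP, mem_filter, mem_univ, true_and]; exact ⟨h1, h2⟩)
        simp only [hz, h3, and_self, if_true] at h4 ⊢
        exact h4
    · simp [hz]
  rw [sum_congr rfl hpair] at hle
  have hPc : (#P : ℝ) ≤ (2 * k) ^ 2 := by
    have : #P ≤ (2 * k) ^ 2 := by
      refine (card_le_univ _).trans (le_of_eq ?_)
      simp [sq]
    exact_mod_cast this
  rcases P.eq_empty_or_nonempty with he | hne
  · rw [he, sum_empty] at hle
    linarith
  · have hk0 : (0 : ℝ) < (2 * k) ^ 2 := lt_of_lt_of_le (by exact_mod_cast card_pos.2 hne) hPc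
    have hlt : ∑ p ∈ P, ∑ b, ∑ c, (if conf b c then (A ^ (p.2.val - p.1.val)) b c *
        (A ^ (2 * k - (p.2.val - p.1.val))) b c else 0) <
        ∑ p ∈ P, closedWalkSum A k / (2 * k) ^ 2 := by
      refine sum_lt_sum_of_nonempty hne fun p hp => ?_
      simp only [hP, mem_filter, mem_univ, true_and] at hp
      rw [lt_div_iff₀ hk0, mul_comm]
      exact hconf _ (by omega) (by omega)
    rw [sum_const, nsmul_eq_mul] at hlt
    have : (#P : ℝ) * (closedWalkSum A k / (2 * k) ^ 2) ≤ closedWalkSum A k := by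
      calc _ ≤ (2 * k) ^ 2 * (closedWalkSum A k / (2 * k) ^ 2) := by gcongr
        _ = _ := mul_div_cancel₀ _ hk0.ne'
    linarith

end

/-! ### From a well-spread weighted graph on darts to an induced prism -/

section
open scoped Classical
open Finset

variable {V E : Type*} [Fintype V] [Fintype E]

/-- By `collisionSum_sq_le` it suffices that `t * Δ` times the previous trace is at most `γ ^ 2`
times the current one. Log-convexity together with the lower bound `d ^ (2 * k)` on the trace
reduces this to `hγd`. -/
theorem collisionSum_le {A : Matrix E E ℝ} [Nonempty E] (hA : A.IsSymm) (h0 : ∀ i j, 0 ≤ A i j)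
    (α : E → V) {t Δ d γ : ℝ} (ht : 0 ≤ t)
    (htA : ∀ z v, ∑ u, (if α u = v then A z u else 0) ≤ t) (hΔ : ∀ z, ∑ u, A z u ≤ Δ)
    (hd : 0 < d) (hsum : Fintype.card E * d ≤ ∑ e, ∑ f, A e f) (hγ : 0 ≤ γ) {k : ℕ}
    (hγd : (t * Δ) ^ k * Fintype.card E ≤ (γ * d) ^ (2 * k)) {p q : ℕ}
    (hp : 1 ≤ p) (hq : 1 ≤ q) (hk : p + q = k) :
    collisionSum A α p q ≤ γ * closedWalkSum A k := by
  obtain ⟨j, rfl⟩ : ∃ j, k = j + 1 := ⟨k - 1, by omega⟩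
  have hpow := pow_le_closedWalkSum hA hd hsum
  have hpos : ∀ j, 0 < closedWalkSum A j := fun j => lt_of_lt_of_le (pow_pos hd _) (hpow j)
  have h1 := collisionSum_sq_le hA h0 α ht htA hΔ hp hq hk
  have h2 := closedWalkSum_pow_le hA hpos j
  have hΔ0 : 0 ≤ Δ := (sum_nonneg fun u _ => h0 (Classical.arbitrary E) u).trans (hΔ _)
  have h3 : t * Δ * closedWalkSum A j ≤ γ ^ 2 * closedWalkSum A (j + 1) := by
    refine le_of_pow_le_pow_left₀ (n := j + 1) (by omega)
      (mul_nonneg (sq_nonneg _) (hpos _).le) ?_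
    calc (t * Δ * closedWalkSum A j) ^ (j + 1)
        = (t * Δ) ^ (j + 1) * closedWalkSum A j ^ (j + 1) := mul_pow _ _ _
      _ ≤ (t * Δ) ^ (j + 1) * (Fintype.card E * closedWalkSum A (j + 1) ^ j) :=
          mul_le_mul_of_nonneg_left h2 (pow_nonneg (mul_nonneg ht hΔ0) _)
      _ = (t * Δ) ^ (j + 1) * Fintype.card E * closedWalkSum A (j + 1) ^ j := by ring
      _ ≤ (γ * d) ^ (2 * (j + 1)) * closedWalkSum A (j + 1) ^ j :=
          mul_le_mul_of_nonneg_right hγd (pow_nonneg (hpos _).le _)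
      _ = γ ^ (2 * (j + 1)) * closedWalkSum A (j + 1) ^ j * d ^ (2 * (j + 1)) := by ring
      _ ≤ γ ^ (2 * (j + 1)) * closedWalkSum A (j + 1) ^ j * closedWalkSum A (j + 1) :=
          mul_le_mul_of_nonneg_left (hpow _)
            (mul_nonneg (pow_nonneg hγ _) (pow_nonneg (hpos _).le _))
      _ = (γ ^ 2 * closedWalkSum A (j + 1)) ^ (j + 1) := by ring
  refine le_of_sq_le_sq ?_ (mul_nonneg hγ (hpos _).le)
  calc _ ≤ _ := h1
    _ ≤ γ ^ 2 * closedWalkSum A (j + 1) * closedWalkSum A (j + 1) :=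
        mul_le_mul_of_nonneg_right h3 (hpos _).le
    _ = _ := by ring

/-- A weighted graph on the darts of `G` whose weights are well spread contains a closed walk
that traces an induced prism. -/
theorem prism_of_weighted_darts {G : SimpleGraph V} [Nonempty E] {A : Matrix E E ℝ}
    (hA : A.IsSymm) (h0 : ∀ i j, 0 ≤ A i j) (x y : E → V) (hxy : ∀ z, G.Adj (x z) (y z))
    (hadj : ∀ z z', A z z' ≠ 0 →
      G.Adj (x z) (y z') ∧ ¬ G.Adj (x z) (x z') ∧ ¬ G.Adj (y z) (y z'))
    {t Δ d γ η : ℝ} (ht : 0 ≤ t)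
    (htx : ∀ z v, ∑ u, (if x u = v then A z u else 0) ≤ t)
    (hty : ∀ z v, ∑ u, (if y u = v then A z u else 0) ≤ t) (hΔ : ∀ z, ∑ u, A z u ≤ Δ)
    (hd : 0 < d) (hsum : Fintype.card E * d ≤ ∑ e, ∑ f, A e f) (hγ : 0 ≤ γ) {k : ℕ} (hk : 2 ≤ k)
    (hγd : (t * Δ) ^ k * Fintype.card E ≤ (γ * d) ^ (2 * k)) {w : ℕ} (hw : 1 ≤ w)
    (hsp : ∀ W : Finset V, #W ≤ 2 * w → (adjPairs G W : ℝ) ≤ η * w ^ 2)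
    (hfin : (2 * k) ^ 2 * (4 * (η + 2 * w * γ)) < 1) :
    (prismGraph (2 * k)).IsIndContained G := by
  have hpos : ∀ j, 0 < closedWalkSum A j := fun j =>
    lt_of_lt_of_le (pow_pos hd _) (pow_le_closedWalkSum hA hd hsum j)
  have hnn := Matrix.pow_apply_nonneg h0
  have hcx : ∀ p q, 1 ≤ p → 1 ≤ q → p + q = k → collisionSum A x p q ≤ γ * closedWalkSum A k :=
    fun p q => collisionSum_le hA h0 x ht htx hΔ hd hsum hγ hγd
  have hcy : ∀ p q, 1 ≤ p → 1 ≤ q → p + q = k → collisionSum A y p q ≤ γ * closedWalkSum A k :=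
    fun p q => collisionSum_le hA h0 y ht hty hΔ hd hsum hγ hγd
  set δ : ℝ := (η + 2 * w * γ) * closedWalkSum A k with hδ
  have hw0 : (0 : ℝ) ≤ w := Nat.cast_nonneg _
  have hpair : ∀ α β : E → V, (α = x ∨ α = y) → (β = x ∨ β = y) → ∀ r, 2 ≤ r → r ≤ k →
      ∑ u, ∑ u', (if G.Adj (α u) (β u') then (A ^ r) u u' * (A ^ (2 * k - r)) u u' else 0) ≤ δ := by
    intro α β hα hβ r h1 h2
    refine (sum_adj_pow_mul_pow_le hA h0 w hw η hsp α β h1 h2).trans ?_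
    have e1 : collisionSum A α 1 (k - 1) ≤ γ * closedWalkSum A k := by
      rcases hα with rfl | rfl
      exacts [hcx _ _ (by omega) (by omega) (by omega), hcy _ _ (by omega) (by omega) (by omega)]
    have e2 : collisionSum A β (r - 1) (k + 1 - r) ≤ γ * closedWalkSum A k := by
      rcases hβ with rfl | rfl
      exacts [hcx _ _ (by omega) (by omega) (by omega), hcy _ _ (by omega) (by omega) (by omega)]
    have := mul_le_mul_of_nonneg_left (add_le_add e1 e2) hw0
    rw [hδ]
    linarith
  obtain ⟨conf, hconf⟩ : ∃ conf : E → E → Prop, ∀ u u', conf u u' ↔ (G.Adj (x u) (x u') ∨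
      G.Adj (x u) (y u') ∨ G.Adj (y u) (x u') ∨ G.Adj (y u) (y u')) := ⟨_, fun _ _ => Iff.rfl⟩
  have hsmall : ∀ r, 2 ≤ r → r ≤ k →
      ∑ b, ∑ c, (if conf b c then (A ^ r) b c * (A ^ (2 * k - r)) b c else 0) ≤ 4 * δ := by
    intro r h1 h2
    have hle : ∀ b c, (if conf b c then (A ^ r) b c * (A ^ (2 * k - r)) b c else 0) ≤
        (if G.Adj (x b) (x c) then (A ^ r) b c * (A ^ (2 * k - r)) b c else 0) +
        (if G.Adj (x b) (y c) then (A ^ r) b c * (A ^ (2 * k - r)) b c else 0) +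
        (if G.Adj (y b) (x c) then (A ^ r) b c * (A ^ (2 * k - r)) b c else 0) +
        (if G.Adj (y b) (y c) then (A ^ r) b c * (A ^ (2 * k - r)) b c else 0) := by
      intro b c
      have := mul_nonneg (hnn r b c) (hnn (2 * k - r) b c)
      have := hconf b c
      split_ifs <;> first | linarith | tauto
    refine (sum_le_sum fun b _ => sum_le_sum fun c _ => hle b c).trans ?_
    simp only [sum_add_distrib]
    have e1 := hpair x x (.inl rfl) (.inl rfl) r h1 h2
    have e2 := hpair x y (.inl rfl) (.inr rfl) r h1 h2
    have e3 := hpair y x (.inr rfl) (.inl rfl) r h1 h2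
    have e4 := hpair y y (.inr rfl) (.inr rfl) r h1 h2
    linarith
  have hlt : (2 * k : ℝ) ^ 2 * (4 * δ) < closedWalkSum A k := by
    have := mul_lt_mul_of_pos_right hfin (hpos k)
    rw [hδ]
    linarith
  obtain ⟨z, hz, hstep, hfar⟩ := exists_closed_walk hA h0 k conf (by
    intro r h1 h2
    refine lt_of_le_of_lt (mul_le_mul_of_nonneg_left ?_ (by positivity)) hlt
    by_cases h : r ≤ k
    · exact hsmall r h1 h
    -- Distances beyond `k` are measured along the other arc.
    · have := hsmall (2 * k - r) (by omega) (by omega)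
      rw [show 2 * k - (2 * k - r) = r by omega] at this
      simpa only [mul_comm] using this) (hpos k)
  have hnext : ∀ i j : Fin (2 * k), (i.val + 1 = j.val ∨ (j.val = 0 ∧ i.val + 1 = 2 * k)) →
      z i.succ = z j.castSucc := by
    rintro i j (h | ⟨h, h'⟩)
    · exact congrArg z (Fin.ext (by simpa using h))
    · rw [show i.succ = Fin.last _ from Fin.ext (by simpa using h'), ← hz]
      exact congrArg z (Fin.ext (by simpa using h.symm))
  have hcons : ∀ i j : Fin (2 * k), (SimpleGraph.cycleGraph (2 * k)).Adj i j →
      A (z i.castSucc) (z j.castSucc) ≠ 0 := by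
    intro i j h
    rw [cycleGraph_adj_iff_val (by omega)] at h
    by_cases h' : i.val + 1 = j.val ∨ (j.val = 0 ∧ i.val + 1 = 2 * k)
    · rw [← hnext i j h']
      exact hstep i
    · rw [← hnext j i (by omega), ← hA.apply]
      exact hstep j
  have hnot : ∀ i j : Fin (2 * k), i ≠ j → ¬ (SimpleGraph.cycleGraph (2 * k)).Adj i j →
      ¬ conf (z i.castSucc) (z j.castSucc) := by
    intro i j hne h
    rw [cycleGraph_adj_iff_val (by omega)] at h
    have hne' : i.val ≠ j.val := fun h => hne (Fin.ext h)
    have hi := i.isLt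
    have hj := j.isLt
    rcases lt_or_gt_of_ne hne' with h' | h'
    · exact hfar i j (by omega) (by omega)
    · have := hfar j i (by omega) (by omega)
      simp only [hconf, not_or] at this ⊢
      exact ⟨fun h => this.1 h.symm, fun h => this.2.2.1 h.symm, fun h => this.2.1 h.symm,
        fun h => this.2.2.2 h.symm⟩
  -- Consecutive darts are governed by the support of the matrix, all others by the absence of
  -- conflicts. Distinctness of the vertices need not be checked.
  refine prism_isIndContained_of_rungs hk (fun i => x (z i.castSucc)) (fun i => y (z i.castSucc))
    ?_ ?_ ?_
  · intro i j
    constructor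
    · intro h
      by_contra hcon
      rw [not_or] at hcon
      exact hnot j i hcon.1 hcon.2 ((hconf _ _).2 (Or.inr (Or.inl h)))
    · rintro (rfl | h)
      · exact hxy _
      · exact (hadj _ _ (hcons j i h)).1
  · intro i j h
    by_cases hij : i = j
    · exact G.ne_of_adj h (by rw [hij])
    by_cases hc : (SimpleGraph.cycleGraph (2 * k)).Adj i j
    · exact (hadj _ _ (hcons i j hc)).2.1 h
    · exact hnot i j hij hc ((hconf _ _).2 (Or.inl h))
  · intro i j h
    by_cases hij : i = j
    · exact G.ne_of_adj h (by rw [hij])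
    by_cases hc : (SimpleGraph.cycleGraph (2 * k)).Adj i j
    · exact (hadj _ _ (hcons i j hc)).2.2 h
    · exact hnot i j hij hc ((hconf _ _).2 (Or.inr (Or.inr (Or.inr h))))

end

/-! ### Almost regular subgraphs -/

section
open scoped Classical
open Finset

variable {V : Type*} [Fintype V]

/-- A set maximizing the ratio of the square of the number of edges to the cube of the size. -/
theorem exists_max_adjPairs_ratio [Nonempty V] (G : SimpleGraph V) :
    ∃ U : Finset V, U.Nonempty ∧
      ∀ S : Finset V, adjPairs G S ^ 2 * #U ^ 3 ≤ adjPairs G U ^ 2 * #S ^ 3 := by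
  obtain ⟨U, hU, hmax⟩ := exists_max_image (univ.filter fun U : Finset V => U.Nonempty)
    (fun U => (adjPairs G U : ℝ) ^ 2 / (#U : ℝ) ^ 3) ⟨univ, by simp⟩
  have hUne : U.Nonempty := (mem_filter.1 hU).2
  refine ⟨U, hUne, fun S => ?_⟩
  rcases S.eq_empty_or_nonempty with rfl | hS
  · simp [adjPairs]
  · have h := hmax S (by simp [hS])
    have h1 : (0 : ℝ) < (#S : ℝ) ^ 3 := by have := hS.card_pos; positivity
    have h2 : (0 : ℝ) < (#U : ℝ) ^ 3 := by have := hUne.card_pos; positivity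
    rw [div_le_div_iff₀ h1 h2] at h
    exact_mod_cast h

theorem sum_card_adj_comm {V : Type*} (G : SimpleGraph V) (S T : Finset V) :
    ∑ v ∈ S, #{a ∈ T | G.Adj v a} = ∑ v ∈ T, #{a ∈ S | G.Adj v a} := by
  simp only [card_filter]
  rw [sum_comm]
  exact sum_congr rfl fun u _ => sum_congr rfl fun v _ => by rw [G.adj_comm]

theorem adjPairs_le_sdiff_add {V : Type*} (G : SimpleGraph V) {U Z : Finset V} (hZ : Z ⊆ U) :
    adjPairs G U ≤ adjPairs G (U \ Z) + 2 * ∑ v ∈ Z, #{a ∈ U | G.Adj v a} := by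
  have hsplit : ∀ v, #{a ∈ U | G.Adj v a} =
      #{a ∈ U \ Z | G.Adj v a} + #{a ∈ Z | G.Adj v a} := by
    intro v
    simp only [card_filter]
    exact (sum_sdiff hZ).symm
  have h1 : adjPairs G U =
      ∑ v ∈ U \ Z, #{a ∈ U | G.Adj v a} + ∑ v ∈ Z, #{a ∈ U | G.Adj v a} := by
    rw [adjPairs_eq_sum, sum_sdiff hZ]
  have h2 : ∑ v ∈ U \ Z, #{a ∈ U | G.Adj v a} =
      adjPairs G (U \ Z) + ∑ v ∈ U \ Z, #{a ∈ Z | G.Adj v a} := by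
    rw [adjPairs_eq_sum, ← sum_add_distrib]
    exact sum_congr rfl fun v _ => hsplit v
  have h3 : ∑ v ∈ U \ Z, #{a ∈ Z | G.Adj v a} ≤ ∑ v ∈ Z, #{a ∈ U | G.Adj v a} := by
    rw [sum_card_adj_comm]
    exact sum_le_sum fun v _ => card_le_card (filter_subset_filter _ sdiff_subset)
  omega

/-- Every graph with an edge has a dense induced subgraph whose maximum degree is bounded by a
multiple of its average degree. -/
theorem exists_almost_regular_subset [Nonempty V] (G : SimpleGraph V)
    (hE : 0 < adjPairs G univ) :
    ∃ (W : Finset V) (m : ℕ) (D : ℝ), 0 < m ∧ 0 < D ∧ #W ≤ m ∧ D ≤ m ∧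
      (adjPairs G univ : ℝ) ^ 2 * m ≤ D ^ 2 * (Fintype.card V : ℝ) ^ 3 ∧
      D * m ≤ 2 * adjPairs G W ∧ (adjPairs G W : ℝ) ≤ D * m ∧
      ∀ v ∈ W, (#{a ∈ W | G.Adj v a} : ℝ) ≤ 130 * D := by
  obtain ⟨U, hU, hmax⟩ := exists_max_adjPairs_ratio G
  set m := #U with hm
  set e := adjPairs G U with he
  have hm0 : 0 < m := hU.card_pos
  have hmR : (0 : ℝ) < m := by exact_mod_cast hm0
  have hcard := hmax univ
  rw [card_univ] at hcard
  have he0 : 0 < e := by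
    by_contra h
    have h0 : e = 0 := by omega
    rw [h0] at hcard
    have : 0 < adjPairs G univ ^ 2 * m ^ 3 := by positivity
    omega
  have heR : (0 : ℝ) < e := by exact_mod_cast he0
  set D : ℝ := e / m with hD
  have hDm : D * m = e := by rw [hD]; field_simp
  have hD0 : 0 < D := by positivity
  set Z : Finset V := {v ∈ U | 130 * D < (#{a ∈ U | G.Adj v a} : ℝ)} with hZ
  have hZU : Z ⊆ U := filter_subset _ _
  have hsumU : ∑ v ∈ U, (#{a ∈ U | G.Adj v a} : ℝ) = e := by
    rw [he, adjPairs_eq_sum]; push_cast; rfl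
  have hZcard : (130 : ℝ) * #Z ≤ m := by
    have h1 : (#Z : ℝ) * (130 * D) ≤ ∑ v ∈ Z, (#{a ∈ U | G.Adj v a} : ℝ) := by
      rw [← nsmul_eq_mul]
      exact card_nsmul_le_sum _ _ _ fun v hv => (mem_filter.1 hv).2.le
    have h2 : ∑ v ∈ Z, (#{a ∈ U | G.Adj v a} : ℝ) ≤ e := by
      rw [← hsumU]
      exact sum_le_sum_of_subset_of_nonneg hZU fun _ _ _ => Nat.cast_nonneg _
    rw [← hDm] at h2
    have h3 : D * (130 * #Z) ≤ D * m := by linarith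
    exact le_of_mul_le_mul_left h3 hD0
  have hdel := adjPairs_le_sdiff_add G hZU
  set σ := ∑ v ∈ Z, #{a ∈ U | G.Adj v a} with hσ
  -- If `Z` carried many edges, then `Z` with the `#Z` vertices of `U` best joined to it would be a
  -- set of size at most `2 * #Z` that, by maximality of `U`, forces `m < 128 * #Z`. The degree
  -- cutoff `130 * D` gives `130 * #Z ≤ m`.
  have hσ4 : 4 * σ ≤ e := by
    by_contra hcon
    push Not at hcon
    obtain ⟨B, hBU, hBc, hB⟩ := exists_subset_card_eq_sum_ge (fun v => #{a ∈ Z | G.Adj v a})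
      #Z (#U - #Z) U (by have := card_le_card hZU; omega)
    rw [sum_card_adj_comm G U Z, ← hσ, ← hm] at hB
    have hZ0 : 0 < #Z := by
      rcases Z.eq_empty_or_nonempty with h | h
      · rw [hσ, h, sum_empty] at hcon; omega
      · exact h.card_pos
    have hlow : ∑ v ∈ B, #{a ∈ Z | G.Adj v a} ≤ adjPairs G (Z ∪ B) := by
      rw [adjPairs_eq_sum]
      refine (sum_le_sum fun v _ => card_le_card
        (filter_subset_filter _ subset_union_left)).trans
        (sum_le_sum_of_subset subset_union_right)
    have h1 : #Z * e < 4 * m * adjPairs G (Z ∪ B) := by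
      calc #Z * e < #Z * (4 * σ) := Nat.mul_lt_mul_of_pos_left hcon hZ0
        _ = 4 * (#Z * σ) := by ring
        _ ≤ 4 * (m * adjPairs G (Z ∪ B)) :=
            Nat.mul_le_mul_left _ (hB.trans (Nat.mul_le_mul_left _ hlow))
        _ = _ := by ring
    have h2 := hmax (Z ∪ B)
    have h3 : #(Z ∪ B) ≤ 2 * #Z := (card_union_le _ _).trans (by omega)
    have h4 : (#Z * e) ^ 2 < (4 * m * adjPairs G (Z ∪ B)) ^ 2 :=
      Nat.pow_lt_pow_left h1 (by norm_num)
    have h5 : (#Z ^ 2 * e ^ 2) * m < (#Z ^ 2 * e ^ 2) * (128 * #Z) := by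
      calc (#Z ^ 2 * e ^ 2) * m = (#Z * e) ^ 2 * m := by ring
        _ < (4 * m * adjPairs G (Z ∪ B)) ^ 2 * m := Nat.mul_lt_mul_of_pos_right h4 hm0
        _ = 16 * (adjPairs G (Z ∪ B) ^ 2 * m ^ 3) := by ring
        _ ≤ 16 * (e ^ 2 * #(Z ∪ B) ^ 3) := Nat.mul_le_mul_left _ h2
        _ ≤ 16 * (e ^ 2 * (2 * #Z) ^ 3) := by gcongr
        _ = _ := by ring
    have h6 := lt_of_mul_lt_mul_left h5 (Nat.zero_le _)
    have h7 : 130 * #Z ≤ m := by exact_mod_cast hZcard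
    omega
  have hWe : adjPairs G (U \ Z) ≤ e := adjPairs_mono G sdiff_subset
  refine ⟨U \ Z, m, D, hm0, hD0, card_le_card sdiff_subset, ?_, ?_, ?_, ?_, ?_⟩
  · rw [hD, div_le_iff₀ hmR]
    have := adjPairs_le_sq G U
    rw [← sq]
    exact_mod_cast this
  · have h1 : (adjPairs G univ : ℝ) ^ 2 * m ^ 3 ≤ e ^ 2 * (Fintype.card V : ℝ) ^ 3 := by
      exact_mod_cast hcard
    rw [← hDm] at h1
    have h2 : (m : ℝ) ^ 2 * ((adjPairs G univ : ℝ) ^ 2 * m) ≤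
        (m : ℝ) ^ 2 * (D ^ 2 * (Fintype.card V : ℝ) ^ 3) := by
      linarith
    exact le_of_mul_le_mul_left h2 (by positivity)
  · rw [hDm]
    have : e ≤ 2 * adjPairs G (U \ Z) := by omega
    exact_mod_cast this
  · rw [hDm]
    exact_mod_cast hWe
  · intro v hv
    rw [mem_sdiff] at hv
    have h1 : (#{a ∈ U \ Z | G.Adj v a} : ℝ) ≤ #{a ∈ U | G.Adj v a} := by
      exact_mod_cast card_le_card (filter_subset_filter _ sdiff_subset)
    by_contra hcon
    exact hv.2 (mem_filter.2 ⟨hv.1, by linarith⟩)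

end

/-! ### The weighted graph on darts and its row sums -/

section
open scoped Classical
open Finset

variable {V : Type*} [Fintype V]

/-- The neighbourhood of a vertex, as a finset. -/
noncomputable def nbr (G : SimpleGraph V) (v : V) : Finset V := {a | G.Adj v a}

theorem mem_nbr {G : SimpleGraph V} {u v : V} : v ∈ nbr G u ↔ G.Adj u v := by simp [nbr]

/-- The number of common neighbours of two vertices. -/
noncomputable def codeg (G : SimpleGraph V) (u v : V) : ℕ := #(nbr G u ∩ nbr G v)

theorem codeg_comm (G : SimpleGraph V) (u v : V) : codeg G u v = codeg G v u := by
  rw [codeg, codeg, inter_comm]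

/-- The pairs of vertices that are joined by an edge. -/
abbrev Darts (G : SimpleGraph V) : Type _ := {p : V × V // G.Adj p.1 p.2}

/-- The weight of a non-adjacent pair of codegree at least `κ` is its inverse codegree. -/
noncomputable def pairWeight (G : SimpleGraph V) (κ : ℕ) (y y' : V) : ℝ :=
  if κ ≤ codeg G y y' ∧ ¬ G.Adj y y' then (codeg G y y' : ℝ)⁻¹ else 0

/-- The total weight of the continuations of the dart `(x, y)` to darts that start at `v`. -/
noncomputable def dartLoad (G : SimpleGraph V) (κ : ℕ) (x y v : V) : ℝ :=
  ∑ y' ∈ nbr G x ∩ nbr G v, pairWeight G κ y y'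

/-- The weighted graph on the darts of `G` whose closed walks trace prisms. -/
noncomputable def dartMatrix (G : SimpleGraph V) (κ : ℕ) (θ : ℝ) :
    Matrix (Darts G) (Darts G) ℝ := fun z z' =>
  if (G.Adj z.1.1 z'.1.2 ∧ G.Adj z'.1.1 z.1.2) ∧ ¬ G.Adj z.1.1 z'.1.1 ∧
      dartLoad G κ z.1.1 z.1.2 z'.1.1 ≤ θ ∧ dartLoad G κ z'.1.1 z'.1.2 z.1.1 ≤ θ
    then pairWeight G κ z.1.2 z'.1.2 else 0

variable {G : SimpleGraph V} {κ : ℕ} {θ : ℝ}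

theorem pairWeight_nonneg (y y' : V) : 0 ≤ pairWeight G κ y y' := by
  rw [pairWeight]
  split_ifs
  exacts [inv_nonneg.2 (Nat.cast_nonneg _), le_rfl]

theorem pairWeight_comm (y y' : V) : pairWeight G κ y y' = pairWeight G κ y' y := by
  rw [pairWeight, pairWeight, codeg_comm, G.adj_comm]

theorem codeg_mul_pairWeight (hκ : 1 ≤ κ) (y y' : V) :
    codeg G y y' * pairWeight G κ y y' =
      if κ ≤ codeg G y y' ∧ ¬ G.Adj y y' then 1 else 0 := by
  rw [pairWeight]
  split_ifs with h
  · have : (0 : ℝ) < codeg G y y' := by exact_mod_cast lt_of_lt_of_le hκ h.1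
    exact mul_inv_cancel₀ this.ne'
  · exact mul_zero _

theorem codeg_mul_pairWeight_le (hκ : 1 ≤ κ) (y y' : V) :
    codeg G y y' * pairWeight G κ y y' ≤ 1 := by
  rw [codeg_mul_pairWeight hκ]
  split_ifs <;> norm_num

theorem pairWeight_le (hκ : 1 ≤ κ) (y y' : V) : pairWeight G κ y y' ≤ (κ : ℝ)⁻¹ := by
  rw [pairWeight]
  split_ifs with h
  · have : (0 : ℝ) < κ := by exact_mod_cast hκ
    exact inv_anti₀ this (by exact_mod_cast h.1)
  · positivity

theorem dartLoad_nonneg (x y v : V) : 0 ≤ dartLoad G κ x y v :=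
  sum_nonneg fun _ _ => pairWeight_nonneg _ _

theorem sum_darts (f : V → V → ℝ) :
    ∑ z : Darts G, f z.1.1 z.1.2 = ∑ x, ∑ y ∈ nbr G x, f x y := by
  rw [← Finset.sum_subtype (univ.filter fun p : V × V => G.Adj p.1 p.2) (by simp)
    (fun p => f p.1 p.2), sum_filter, Fintype.sum_prod_type]
  exact sum_congr rfl fun x _ => by rw [nbr, sum_filter]

theorem card_darts : Fintype.card (Darts G) = adjPairs G univ := by
  rw [Fintype.card_subtype, adjPairs, univ_product_univ]

theorem adjPairs_univ : adjPairs G univ = ∑ v, #(nbr G v) := adjPairs_eq_sum _ _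

theorem dartMatrix_isSymm : (dartMatrix G κ θ).IsSymm := by
  ext z z'
  simp only [Matrix.transpose_apply, dartMatrix]
  rw [pairWeight_comm z'.1.2, G.adj_comm z'.1.1 z.1.1]
  exact if_congr (by tauto) rfl rfl

theorem dartMatrix_nonneg (z z' : Darts G) : 0 ≤ dartMatrix G κ θ z z' := by
  rw [dartMatrix]
  split_ifs
  exacts [pairWeight_nonneg _ _, le_rfl]

theorem adj_of_dartMatrix_ne_zero (z z' : Darts G) (h : dartMatrix G κ θ z z' ≠ 0) :
    G.Adj z.1.1 z'.1.2 ∧ ¬ G.Adj z.1.1 z'.1.1 ∧ ¬ G.Adj z.1.2 z'.1.2 := by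
  rw [dartMatrix] at h
  split_ifs at h with h1
  · rw [pairWeight] at h
    split_ifs at h with h2
    · exact ⟨h1.1.1, h1.2.1, h2.2⟩
    · exact absurd rfl h
  · exact absurd rfl h

/-- The continuations of a dart, sorted by their first vertex. -/
theorem sum_continuations (x y : V) (p : V → Prop) :
    ∑ z : Darts G, (if (G.Adj x z.1.2 ∧ G.Adj z.1.1 y) ∧ p z.1.1
      then pairWeight G κ y z.1.2 else 0) =
    ∑ v ∈ nbr G y with p v, dartLoad G κ x y v := by
  rw [sum_darts (fun a b => if (G.Adj x b ∧ G.Adj a y) ∧ p a then pairWeight G κ y b else 0),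
    sum_filter, nbr, sum_filter]
  refine sum_congr rfl fun v _ => ?_
  rw [dartLoad, inter_comm]
  simp only [nbr]
  by_cases h1 : G.Adj v y
  · by_cases h2 : p v
    · simp only [h1, h1.symm, h2, and_true, if_true]
      rw [← sum_filter]
      exact sum_congr (by ext; simp) fun _ _ => rfl
    · simp [h2]
  · simp [h1, G.adj_comm y v]

/-- Each `y'` is reached through `codeg G y y'` vertices `v`, which cancels the inverse codegree in
the weight. This is the purpose of the normalisation: row sums become degree counts. -/
theorem sum_dartLoad (hκ : 1 ≤ κ) (x y : V) :
    ∑ v ∈ nbr G y, dartLoad G κ x y v =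
      ∑ y' ∈ nbr G x, if κ ≤ codeg G y y' ∧ ¬ G.Adj y y' then (1 : ℝ) else 0 := by
  simp only [← codeg_mul_pairWeight hκ, dartLoad]
  have h : ∀ v, ∑ y' ∈ nbr G x ∩ nbr G v, pairWeight G κ y y' =
      ∑ y' ∈ nbr G x, if G.Adj v y' then pairWeight G κ y y' else 0 := by
    intro v
    rw [← sum_filter]
    exact sum_congr (by ext; simp [mem_nbr]) fun _ _ => rfl
  simp only [h]
  rw [sum_comm]
  refine sum_congr rfl fun y' _ => ?_
  rw [← sum_filter, sum_const, nsmul_eq_mul, codeg]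
  congr 3
  ext
  simp [mem_nbr, G.adj_comm]

theorem sum_dartLoad_le (hκ : 1 ≤ κ) (x y : V) :
    ∑ v ∈ nbr G y, dartLoad G κ x y v ≤ #(nbr G x) := by
  rw [sum_dartLoad hκ, card_eq_sum_ones]
  push_cast
  exact sum_le_sum fun _ _ => by split_ifs <;> norm_num

theorem dartMatrix_row_sum_le (hκ : 1 ≤ κ) {Δ : ℝ} (hΔ : ∀ v, (#(nbr G v) : ℝ) ≤ Δ)
    (z : Darts G) : ∑ u, dartMatrix G κ θ z u ≤ Δ := by
  refine le_trans ?_ ((sum_dartLoad_le hκ z.1.1 z.1.2).trans (hΔ _))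
  have h := sum_continuations (G := G) (κ := κ) z.1.1 z.1.2 (fun _ => True)
  rw [filter_true] at h
  rw [← h]
  refine sum_le_sum fun u _ => ?_
  have := pairWeight_nonneg (G := G) (κ := κ) z.1.2 u.1.2
  rw [dartMatrix]
  split_ifs <;> first | exact le_rfl | exact this | tauto

/-- The cap on loads in `dartMatrix` exists for this bound; it is imposed in both directions so that
the matrix remains symmetric. -/
theorem dartMatrix_fst_sum_le (hθ : 0 ≤ θ) (z : Darts G) (v : V) :
    ∑ u : Darts G, (if u.1.1 = v then dartMatrix G κ θ z u else 0) ≤ θ := by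
  by_cases hv : dartLoad G κ z.1.1 z.1.2 v ≤ θ
  · have h := sum_continuations (G := G) (κ := κ) z.1.1 z.1.2 (fun a => a = v)
    have h2 : ∑ a ∈ nbr G z.1.2 with a = v, dartLoad G κ z.1.1 z.1.2 a ≤ θ := by
      refine (sum_le_sum_of_subset_of_nonneg (t := {v}) ?_
        fun _ _ _ => dartLoad_nonneg _ _ _).trans (by rwa [sum_singleton])
      intro a ha
      exact mem_singleton.2 (mem_filter.1 ha).2
    rw [← h] at h2
    refine le_trans (sum_le_sum fun u _ => ?_) h2
    have := pairWeight_nonneg (G := G) (κ := κ) z.1.2 u.1.2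
    rw [dartMatrix]
    split_ifs <;> first | exact le_rfl | exact this | tauto
  · refine le_trans (le_of_eq (sum_eq_zero fun u _ => ?_)) hθ
    split_ifs with hu
    · rw [dartMatrix, if_neg]
      rw [hu]
      tauto
    · rfl

/-- For a fixed new second vertex the new first vertex is a common neighbour, so at most `codeg`
many entries of size `1 / codeg` are summed. -/
theorem dartMatrix_snd_sum_le (hκ : 1 ≤ κ) (z : Darts G) (v : V) :
    ∑ u : Darts G, (if u.1.2 = v then dartMatrix G κ θ z u else 0) ≤ 1 := by
  refine le_trans ?_ (codeg_mul_pairWeight_le (G := G) hκ z.1.2 v)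
  have hnn := pairWeight_nonneg (G := G) (κ := κ) z.1.2 v
  have h1 : ∑ u : Darts G, (if u.1.2 = v then dartMatrix G κ θ z u else 0) ≤
      ∑ u : Darts G, (if u.1.2 = v ∧ G.Adj z.1.2 u.1.1 then pairWeight G κ z.1.2 v else 0) := by
    refine sum_le_sum fun u _ => ?_
    by_cases hu : u.1.2 = v
    · rw [if_pos hu, dartMatrix, hu]
      split_ifs with h2 h3 <;> first | exact le_rfl | exact hnn | skip
      exact absurd ⟨rfl, h2.1.2.symm⟩ h3
    · simp [hu]
  refine h1.trans (le_of_eq ?_)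
  rw [sum_darts (fun a b => if b = v ∧ G.Adj z.1.2 a then pairWeight G κ z.1.2 v else 0)]
  have h2 : ∀ a, ∑ b ∈ nbr G a, (if b = v ∧ G.Adj z.1.2 a then pairWeight G κ z.1.2 v else 0) =
      if a ∈ nbr G z.1.2 ∩ nbr G v then pairWeight G κ z.1.2 v else 0 := by
    intro a
    simp only [ite_and, sum_ite_eq', mem_inter, mem_nbr, G.adj_comm v a]
    split_ifs <;> rfl
  simp only [h2]
  rw [sum_ite_mem, univ_inter, sum_const, nsmul_eq_mul, codeg]

end

/-! ### Weight lost to small codegrees, chords and overloaded continuations -/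

section
open scoped Classical
open Finset

variable {V : Type*} [Fintype V] {G : SimpleGraph V} {κ : ℕ} {θ : ℝ}

/-- The factor two accounts for overloads seen from either dart, which have equal total by symmetry.
-/
theorem sum_dartMatrix_ge :
    ∑ z : Darts G, ∑ v ∈ nbr G z.1.2, dartLoad G κ z.1.1 z.1.2 v -
      ∑ z : Darts G, ∑ v ∈ nbr G z.1.2 with G.Adj z.1.1 v, dartLoad G κ z.1.1 z.1.2 v -
      2 * ∑ z : Darts G, ∑ v ∈ nbr G z.1.2 with θ < dartLoad G κ z.1.1 z.1.2 v,
        dartLoad G κ z.1.1 z.1.2 v ≤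
    ∑ z, ∑ z', dartMatrix G κ θ z z' := by
  set F : (Darts G → V → Prop) → Darts G → Darts G → ℝ := fun p z z' =>
    if (G.Adj z.1.1 z'.1.2 ∧ G.Adj z'.1.1 z.1.2) ∧ p z z'.1.1
      then pairWeight G κ z.1.2 z'.1.2 else 0 with hF
  have hsum : ∀ p : Darts G → V → Prop, ∑ z, ∑ z', F p z z' =
      ∑ z : Darts G, ∑ v ∈ nbr G z.1.2 with p z v, dartLoad G κ z.1.1 z.1.2 v := fun p =>
    sum_congr rfl fun z _ => sum_continuations z.1.1 z.1.2 (p z)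
  have h1 := hsum fun _ _ => True
  simp only [filter_true] at h1
  rw [← h1, ← hsum fun z v => G.Adj z.1.1 v, ← hsum fun z v => θ < dartLoad G κ z.1.1 z.1.2 v,
    two_mul]
  nth_rewrite 2 [sum_comm (f := F fun z v => θ < dartLoad G κ z.1.1 z.1.2 v)]
  simp only [← sum_sub_distrib, ← sum_add_distrib]
  refine sum_le_sum fun z _ => sum_le_sum fun z' _ => ?_
  have := pairWeight_nonneg (G := G) (κ := κ) z.1.2 z'.1.2
  simp only [hF, dartMatrix, pairWeight_comm z'.1.2, and_true, G.adj_comm z'.1.1 z.1.2,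
    and_comm (a := G.Adj z.1.2 z'.1.1)]
  by_cases ha : G.Adj z.1.1 z'.1.2 ∧ G.Adj z.1.2 z'.1.1
  · simp only [G.adj_comm z.1.2 z'.1.1] at ha
    simp only [ha, ha.2.symm, and_self, true_and, if_true]
    by_cases h2 : G.Adj z.1.1 z'.1.1 <;>
    by_cases h3 : θ < dartLoad G κ z.1.1 z.1.2 z'.1.1 <;>
    by_cases h4 : θ < dartLoad G κ z'.1.1 z'.1.2 z.1.1 <;>
    simp only [h2, h3, h4, not_lt.1, if_true, if_false, not_true, not_false_eq_true,
      ← not_lt, and_false, and_true] <;> linarith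
  · simp [ha]

theorem sum_sum_codeg : ∑ y, ∑ y', (codeg G y y' : ℝ) = ∑ x, (#(nbr G x) : ℝ) ^ 2 := by
  have h : ∀ y y', (codeg G y y' : ℝ) = ∑ x, if G.Adj x y ∧ G.Adj x y' then (1 : ℝ) else 0 := by
    intro y y'
    rw [codeg, card_eq_sum_ones, ← sum_filter]
    push_cast
    exact sum_congr (by ext; simp [mem_nbr, G.adj_comm]) fun _ _ => rfl
  simp only [h]
  have h2 : ∀ y, ∑ y', ∑ x, (if G.Adj x y ∧ G.Adj x y' then (1 : ℝ) else 0) =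
      ∑ x, ∑ y', (if G.Adj x y ∧ G.Adj x y' then (1 : ℝ) else 0) := fun y => sum_comm
  simp only [h2]
  rw [sum_comm]
  refine sum_congr rfl fun x _ => ?_
  rw [sq, card_eq_sum_ones, nbr]
  push_cast
  rw [sum_mul_sum, sum_filter]
  refine sum_congr rfl fun y _ => ?_
  rw [sum_filter]
  by_cases hy : G.Adj x y <;> simp [hy]

theorem adjPairs_eq_sum_ite (S : Finset V) : (adjPairs G S : ℝ) =
    ∑ x, ∑ v, if (x ∈ S ∧ v ∈ S) ∧ G.Adj x v then (1 : ℝ) else 0 := by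
  rw [adjPairs, card_eq_sum_ones]
  push_cast
  rw [← Fintype.sum_prod_type' (f := fun x v => if (x ∈ S ∧ v ∈ S) ∧ G.Adj x v then (1 : ℝ) else 0),
    ← sum_filter]
  exact sum_congr (by ext; simp) fun _ _ => rfl

/-- Few weighted quadruples have adjacent first vertices. -/
theorem mul_sum_adj_dartLoad_le (hκ : 1 ≤ κ) {K : ℕ}
    (hsp : ∀ W : Finset V, adjPairs G W ^ 4 ≤ K * #W ^ 7) (c : ℕ) (hc : c ^ 4 * K ≤ κ) :
    c * ∑ z : Darts G, ∑ v ∈ nbr G z.1.2 with G.Adj z.1.1 v, dartLoad G κ z.1.1 z.1.2 v ≤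
      ∑ x, (#(nbr G x) : ℝ) ^ 2 := by
  have h1 : ∑ z : Darts G, ∑ v ∈ nbr G z.1.2 with G.Adj z.1.1 v, dartLoad G κ z.1.1 z.1.2 v =
      ∑ y, ∑ y', pairWeight G κ y y' * adjPairs G (nbr G y ∩ nbr G y') := by
    rw [sum_darts fun x y => ∑ v ∈ nbr G y with G.Adj x v, dartLoad G κ x y v]
    simp only [adjPairs_eq_sum_ite, mul_sum]
    calc _ = ∑ x, ∑ y, ∑ v, ∑ y', (pairWeight G κ y y' *
          if (x ∈ nbr G y ∩ nbr G y' ∧ v ∈ nbr G y ∩ nbr G y') ∧ G.Adj x v then (1 : ℝ) else 0) := by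
          refine sum_congr rfl fun x _ => ?_
          rw [nbr, sum_filter]
          refine sum_congr rfl fun y _ => ?_
          rw [sum_filter, nbr, sum_filter]
          by_cases hxy : G.Adj x y
          · rw [if_pos hxy]
            refine sum_congr rfl fun v _ => ?_
            by_cases hyv : G.Adj y v
            · by_cases hxv : G.Adj x v
              · simp only [hyv, hxv, if_true, and_true, mem_inter, mem_nbr,
                  mul_ite, mul_one, mul_zero]
                rw [dartLoad, ← sum_filter]
                exact sum_congr (by ext; simp [mem_nbr, G.adj_comm, hxy, hyv]) fun _ _ => rfl
              · simp [hxv]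
            · simp [hyv, mem_nbr]
          · simp [hxy, mem_nbr, G.adj_comm y x]
      _ = ∑ y, ∑ x, ∑ v, ∑ y', (pairWeight G κ y y' *
          if (x ∈ nbr G y ∩ nbr G y' ∧ v ∈ nbr G y ∩ nbr G y') ∧ G.Adj x v then (1 : ℝ) else 0) :=
          sum_comm
      _ = ∑ y, ∑ x, ∑ y', ∑ v, (pairWeight G κ y y' *
          if (x ∈ nbr G y ∩ nbr G y' ∧ v ∈ nbr G y ∩ nbr G y') ∧ G.Adj x v then (1 : ℝ) else 0) :=
          sum_congr rfl fun y _ => sum_congr rfl fun x _ => sum_comm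
      _ = _ := sum_congr rfl fun y _ => sum_comm
  rw [h1, ← sum_sum_codeg, mul_sum]
  refine sum_le_sum fun y _ => ?_
  rw [mul_sum]
  refine sum_le_sum fun y' _ => ?_
  -- Chords live in the common neighbourhood of `y` and `y'`, which is large here and hence sparse:
  -- the weighted number of chords is at most `codeg / c`.
  by_cases hw : κ ≤ codeg G y y'
  · have h2 := mul_adjPairs_le_sq (hsp (nbr G y ∩ nbr G y')) c (hc.trans hw)
    have h3 : (c * adjPairs G (nbr G y ∩ nbr G y') : ℝ) ≤ (codeg G y y' : ℝ) ^ 2 := by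
      rw [codeg]
      exact_mod_cast h2
    calc _ = pairWeight G κ y y' * (c * adjPairs G (nbr G y ∩ nbr G y') : ℝ) := by ring
      _ ≤ pairWeight G κ y y' * (codeg G y y' : ℝ) ^ 2 :=
          mul_le_mul_of_nonneg_left h3 (pairWeight_nonneg _ _)
      _ = codeg G y y' * (codeg G y y' * pairWeight G κ y y') := by ring
      _ ≤ codeg G y y' * 1 :=
          mul_le_mul_of_nonneg_left (codeg_mul_pairWeight_le hκ y y') (Nat.cast_nonneg _)
      _ = _ := mul_one _
  · rw [pairWeight, if_neg (fun h => hw h.1), zero_mul, mul_zero]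
    exact Nat.cast_nonneg _

/-- A small set receives little of the weight that leaves a dart. -/
theorem sum_dartLoad_le_of_small (hκ : 1 ≤ κ) {B M : ℕ}
    (hst : ∀ S : Finset V, #{y | B ≤ #{a ∈ S | G.Adj y a}} ≤ #S ^ 3 * M) (x y : V)
    (S : Finset V) (hS : S ⊆ nbr G y) :
    ∑ v ∈ S, dartLoad G κ x y v ≤ #(nbr G x) * (B / κ : ℝ) + (#S : ℝ) ^ 3 * M := by
  have hκ0 : (0 : ℝ) < κ := by exact_mod_cast hκ
  have h1 : ∑ v ∈ S, dartLoad G κ x y v =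
      ∑ y' ∈ nbr G x, #{a ∈ S | G.Adj y' a} * pairWeight G κ y y' := by
    have h : ∀ v, dartLoad G κ x y v =
        ∑ y' ∈ nbr G x, if G.Adj y' v then pairWeight G κ y y' else 0 := by
      intro v
      rw [← sum_filter, dartLoad]
      exact sum_congr (by ext; simp [mem_nbr, G.adj_comm]) fun _ _ => rfl
    simp only [h]
    rw [sum_comm]
    exact sum_congr rfl fun y' _ => by rw [← sum_filter, sum_const, nsmul_eq_mul]
  -- A `y'` with fewer than `B` neighbours in `S` contributes at most `B / κ`. Any other contributes
  -- at most 1, and `hst` limits how many of those there are.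
  have h2 : ∀ y', (#{a ∈ S | G.Adj y' a} : ℝ) * pairWeight G κ y y' ≤
      B / κ + if B ≤ #{a ∈ S | G.Adj y' a} then (1 : ℝ) else 0 := by
    intro y'
    have hBκ : (0 : ℝ) ≤ B / κ := by positivity
    split_ifs with hB
    · have h3 : #{a ∈ S | G.Adj y' a} ≤ codeg G y y' := by
        refine card_le_card fun a ha => ?_
        rw [mem_filter] at ha
        exact mem_inter.2 ⟨hS ha.1, mem_nbr.2 ha.2⟩
      have h4 : (#{a ∈ S | G.Adj y' a} : ℝ) * pairWeight G κ y y' ≤ 1 :=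
        (mul_le_mul_of_nonneg_right (by exact_mod_cast h3) (pairWeight_nonneg _ _)).trans
          (codeg_mul_pairWeight_le hκ y y')
      linarith
    · rw [add_zero, div_eq_mul_inv]
      exact mul_le_mul (by exact_mod_cast (not_le.1 hB).le) (pairWeight_le hκ _ _)
        (pairWeight_nonneg _ _) (Nat.cast_nonneg _)
  rw [h1]
  refine (sum_le_sum fun y' _ => h2 y').trans ?_
  rw [sum_add_distrib, sum_const, nsmul_eq_mul]
  refine add_le_add le_rfl ?_
  rw [← sum_filter, sum_const, nsmul_eq_mul, mul_one]
  have : #{y' ∈ nbr G x | B ≤ #{a ∈ S | G.Adj y' a}} ≤ #S ^ 3 * M :=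
    (card_le_card fun a ha => by simpa using (mem_filter.1 ha).2).trans (hst S)
  exact_mod_cast this

/-- The total load is at most the degree, hence at most `g * θ`, so there are at most `g` overloaded
vertices and the bound for small sets applies. -/
theorem sum_heavy_dartLoad_le (hκ : 1 ≤ κ) {B M : ℕ}
    (hst : ∀ S : Finset V, #{y | B ≤ #{a ∈ S | G.Adj y a}} ≤ #S ^ 3 * M) (hθ : 0 < θ) {g : ℕ}
    (hdeg : ∀ v, (#(nbr G v) : ℝ) ≤ g * θ) (x y : V) :
    ∑ v ∈ nbr G y with θ < dartLoad G κ x y v, dartLoad G κ x y v ≤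
      #(nbr G x) * (B / κ : ℝ) + (g : ℝ) ^ 3 * M := by
  refine (sum_dartLoad_le_of_small hκ hst x y _ (filter_subset _ _)).trans ?_
  set S : Finset V := {v ∈ nbr G y | θ < dartLoad G κ x y v}
  have h1 : (#S : ℝ) * θ ≤ g * θ := by
    calc (#S : ℝ) * θ ≤ ∑ v ∈ S, dartLoad G κ x y v := by
          rw [← nsmul_eq_mul]
          exact card_nsmul_le_sum _ _ _ fun v hv => (mem_filter.1 hv).2.le
      _ ≤ ∑ v ∈ nbr G y, dartLoad G κ x y v :=
          sum_le_sum_of_subset_of_nonneg (filter_subset _ _) fun _ _ _ => dartLoad_nonneg _ _ _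
      _ ≤ g * θ := (sum_dartLoad_le hκ x y).trans (hdeg x)
  have h2 : (#S : ℝ) ≤ g := le_of_mul_le_mul_right h1 hθ
  gcongr

/-- Neighbourhoods may be too small for the density bound; the linear term covers that case. -/
theorem mul_adjPairs_le_add {V : Type*} {G : SimpleGraph V} {K : ℕ} {W : Finset V} (h : adjPairs G W ^ 4 ≤ K * #W ^ 7) (c : ℕ) :
    c * adjPairs G W ≤ #W ^ 2 + c * (c ^ 4 * K) * #W := by
  rcases le_or_gt (c ^ 4 * K) #W with hc | hc
  · exact (mul_adjPairs_le_sq h c hc).trans (Nat.le_add_right _ _)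
  · calc c * adjPairs G W ≤ c * #W ^ 2 := Nat.mul_le_mul_left _ (adjPairs_le_sq G W)
      _ = c * #W * #W := by ring
      _ ≤ c * (c ^ 4 * K) * #W := by gcongr
      _ ≤ _ := Nat.le_add_left _ _

/-- The total counts paths `y x y'` whose ends are non-adjacent and of codegree at least `κ`. Each
pair of smaller codegree spoils fewer than `κ` paths, and adjacent pairs are edges inside
neighbourhoods. -/
theorem sum_all_dartLoad_ge (hκ : 1 ≤ κ) :
    ∑ x, (#(nbr G x) : ℝ) ^ 2 - κ * (Fintype.card V : ℝ) ^ 2 - ∑ x, (adjPairs G (nbr G x) : ℝ) ≤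
    ∑ z : Darts G, ∑ v ∈ nbr G z.1.2, dartLoad G κ z.1.1 z.1.2 v := by
  have hlow : ∑ x, ∑ y ∈ nbr G x, ∑ y' ∈ nbr G x, (if codeg G y y' < κ then (1 : ℝ) else 0) ≤
      κ * (Fintype.card V : ℝ) ^ 2 := by
    have h1 : ∀ x, ∑ y ∈ nbr G x, ∑ y' ∈ nbr G x, (if codeg G y y' < κ then (1 : ℝ) else 0) =
        ∑ y, ∑ y', if (x ∈ nbr G y ∩ nbr G y') ∧ codeg G y y' < κ then (1 : ℝ) else 0 := by
      intro x
      rw [nbr, sum_filter]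
      refine sum_congr rfl fun y _ => ?_
      rw [sum_filter]
      by_cases hxy : G.Adj x y
      · rw [if_pos hxy]
        refine sum_congr rfl fun y' _ => ?_
        rw [ite_and]
        exact if_congr (by simp [mem_nbr, hxy.symm, G.adj_comm x]) rfl rfl
      · simp [hxy, mem_nbr, G.adj_comm y x]
    simp only [h1]
    rw [sum_comm]
    calc _ = ∑ y, ∑ y', ∑ x, (if (x ∈ nbr G y ∩ nbr G y') ∧ codeg G y y' < κ
          then (1 : ℝ) else 0) := sum_congr rfl fun y _ => sum_comm
      _ ≤ ∑ y : V, ∑ y' : V, (κ : ℝ) := by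
          refine sum_le_sum fun y _ => sum_le_sum fun y' _ => ?_
          by_cases hc : codeg G y y' < κ
          · simp only [hc, and_true]
            rw [sum_boole, filter_mem_eq_inter, univ_inter]
            exact_mod_cast hc.le
          · simp [hc]
      _ = _ := by simp; ring
  have hadj : ∀ x, (adjPairs G (nbr G x) : ℝ) =
      ∑ y ∈ nbr G x, ∑ y' ∈ nbr G x, if G.Adj y y' then (1 : ℝ) else 0 := by
    intro x
    rw [adjPairs_eq_sum]
    push_cast
    exact sum_congr rfl fun y _ => by rw [sum_boole]
  have hsq : ∀ x, (#(nbr G x) : ℝ) ^ 2 = ∑ y ∈ nbr G x, ∑ y' ∈ nbr G x, (1 : ℝ) := by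
    intro x
    simp [sq]
  simp only [sum_dartLoad hκ]
  rw [sum_darts fun x y => ∑ y' ∈ nbr G x, if κ ≤ codeg G y y' ∧ ¬ G.Adj y y' then (1 : ℝ) else 0]
  have hpt : ∑ x, (#(nbr G x) : ℝ) ^ 2 -
      ∑ x, ∑ y ∈ nbr G x, ∑ y' ∈ nbr G x, (if codeg G y y' < κ then (1 : ℝ) else 0) -
      ∑ x, (adjPairs G (nbr G x) : ℝ) ≤ ∑ x, ∑ y ∈ nbr G x, ∑ y' ∈ nbr G x,
        if κ ≤ codeg G y y' ∧ ¬ G.Adj y y' then (1 : ℝ) else 0 := by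
    simp only [hadj, hsq, ← sum_sub_distrib]
    refine sum_le_sum fun x _ => sum_le_sum fun y _ => sum_le_sum fun y' _ => ?_
    by_cases h1 : codeg G y y' < κ <;> by_cases h2 : G.Adj y y' <;>
    simp [h1, h2, not_le.2, not_lt.1]
  linarith

end

/-! ### Choice of parameters in the almost regular case -/

section
open scoped Classical
open Finset

variable {V : Type*} [Fintype V] {G : SimpleGraph V} {κ : ℕ} {θ : ℝ}

/-- With `N` darts and `P` the sum of squared degrees, Cauchy–Schwarz gives `P ≥ N * D / 2`. The
losses amount to at most `P / 16` and `5 * N * D / 64`, which leaves more than `N * D / 8`. -/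
theorem card_mul_le_sum_dartMatrix {B M K g m : ℕ} {D : ℝ}
    (hst : ∀ S : Finset V, #{y | B ≤ #{a ∈ S | G.Adj y a}} ≤ #S ^ 3 * M)
    (hsp : ∀ W : Finset V, adjPairs G W ^ 4 ≤ K * #W ^ 7)
    (hκ1 : 1 ≤ κ) (hκ : 64 * B + 64 ^ 4 * K ≤ κ) (hθ : 0 < θ)
    (hdeg : ∀ v, (#(nbr G v) : ℝ) ≤ g * θ) (hm : 0 < m) (hn : Fintype.card V ≤ m) (hD : 0 < D)
    (hN : D * m ≤ 2 * adjPairs G univ) (hD1 : 64 * κ * m ≤ D ^ 2)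
    (hD2 : 32 * (64 ^ 4 * K) ≤ D) (hg : 128 * (g ^ 3 * M) ≤ D) :
    (adjPairs G univ : ℝ) * (D / 8) ≤ ∑ z, ∑ z', dartMatrix G κ θ z z' := by
  refine le_trans ?_ sum_dartMatrix_ge
  have hκ0 : (0 : ℝ) < κ := by exact_mod_cast hκ1
  have hm0 : (0 : ℝ) < m := by exact_mod_cast hm
  have hnm : (Fintype.card V : ℝ) ≤ m := by exact_mod_cast hn
  set N : ℝ := (adjPairs G univ : ℝ) with hNdef
  have hN0 : 0 ≤ N := Nat.cast_nonneg _
  set P := ∑ x, (#(nbr G x) : ℝ) ^ 2 with hP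
  have hP0 : 0 ≤ P := sum_nonneg fun _ _ => sq_nonneg _
  have hNsum : N = ∑ x, (#(nbr G x) : ℝ) := by
    rw [hNdef, adjPairs_univ]
    push_cast
    rfl
  have hPN : N * D / 2 ≤ P := by
    have h1 : N ^ 2 ≤ m * P := by
      rw [hNsum]
      refine (sq_sum_le_card_mul_sum_sq (s := univ)).trans ?_
      rw [card_univ]
      exact mul_le_mul_of_nonneg_right hnm hP0
    have h2 : m * (N * D / 2) ≤ m * P := by
      refine le_trans ?_ h1
      have := mul_le_mul_of_nonneg_left hN hN0
      linarith
    exact le_of_mul_le_mul_left h2 hm0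
  have hbase := sum_all_dartLoad_ge (G := G) hκ1
  have hX := mul_sum_adj_dartLoad_le hκ1 hsp 64 (by omega)
  rw [← hP] at hbase hX
  set X := ∑ z : Darts G, ∑ v ∈ nbr G z.1.2 with G.Adj z.1.1 v, dartLoad G κ z.1.1 z.1.2 v
  set Y := ∑ x, (adjPairs G (nbr G x) : ℝ)
  have hY : 64 * Y ≤ P + 64 * (64 ^ 4 * K) * N := by
    rw [hP, hNsum, mul_sum, mul_sum, ← sum_add_distrib]
    exact sum_le_sum fun x _ => by exact_mod_cast mul_adjPairs_le_add (hsp (nbr G x)) 64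
  have hH : ∑ z : Darts G, ∑ v ∈ nbr G z.1.2 with θ < dartLoad G κ z.1.1 z.1.2 v,
      dartLoad G κ z.1.1 z.1.2 v ≤ P * (B / κ) + N * (g ^ 3 * M) := by
    refine (sum_le_sum fun z _ =>
      sum_heavy_dartLoad_le hκ1 hst hθ hdeg z.1.1 z.1.2).trans (le_of_eq ?_)
    rw [sum_darts fun x _ => #(nbr G x) * (B / κ : ℝ) + (g : ℝ) ^ 3 * M, hP, hNsum, sum_mul,
      sum_mul, ← sum_add_distrib]
    refine sum_congr rfl fun x _ => ?_
    rw [sum_const, nsmul_eq_mul]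
    ring
  have hBκ : (B / κ : ℝ) ≤ 1 / 64 := by
    rw [div_le_div_iff₀ hκ0 (by norm_num)]
    have : B * 64 ≤ 1 * κ := by omega
    exact_mod_cast this
  have e1 : P * (B / κ) ≤ P * (1 / 64) := mul_le_mul_of_nonneg_left hBκ hP0
  have e2 : N * (128 * (g ^ 3 * M)) ≤ N * D := mul_le_mul_of_nonneg_left hg hN0
  have e3 : N * (32 * (64 ^ 4 * K)) ≤ N * D := mul_le_mul_of_nonneg_left hD2 hN0
  have e4 : 64 * (κ * (Fintype.card V : ℝ) ^ 2) ≤ 2 * (N * D) := by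
    calc 64 * (κ * (Fintype.card V : ℝ) ^ 2) ≤ 64 * (κ * (m : ℝ) ^ 2) := by gcongr
      _ = 64 * κ * (m : ℝ) * m := by ring
      _ ≤ D ^ 2 * m := mul_le_mul_of_nonneg_right hD1 hm0.le
      _ = D * m * D := by ring
      _ ≤ 2 * N * D := mul_le_mul_of_nonneg_right hN hD.le
      _ = _ := by ring
  push_cast at hX
  linarith [mul_nonneg hN0 hD.le]

/-- An almost regular graph of large degree without dense spots contains an induced prism. -/
theorem prism_of_almost_regular {B M K m k : ℕ} {D : ℝ} (hk : 10 ≤ k) (hM : 1 ≤ M)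
    (hK : 1 ≤ K)
    (hst : ∀ S : Finset V, #{y | B ≤ #{a ∈ S | G.Adj y a}} ≤ #S ^ 3 * M)
    (hsp : ∀ W : Finset V, adjPairs G W ^ 4 ≤ K * #W ^ 7)
    (hdeg : ∀ v, (#(nbr G v) : ℝ) ≤ 130 * D) (hm : 0 < m) (hn : Fintype.card V ≤ m)
    (hN : D * m ≤ 2 * adjPairs G univ) (hN' : adjPairs G univ ≤ D * m)
    (hDm : 64 * (64 * B + 64 ^ 4 * K) * m ≤ D ^ 2)
    (hD : 128 * M * (((64 * 130 ^ 2) ^ k * (1024 * M) ^ 3 *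
      (128 * k ^ 2 * ((256 * k ^ 2) ^ 4 * K * (8 * k))) ^ (2 * k) : ℕ) : ℝ) ^ 3 ≤ D)
    (hDK : 32 * (64 ^ 4 * K) ≤ D) :
    (prismGraph (2 * k)).IsIndContained G := by
  -- Sets of size up to `2 * w` must have at most `w ^ 2 / (64 * k ^ 2)` adjacent pairs. Large ones
  -- do by the density bound; for sets below `(256 * k ^ 2) ^ 4 * K` the trivial bound suffices
  -- thanks to the factor `8 * k`.
  set w : ℕ := (256 * k ^ 2) ^ 4 * K * (8 * k) with hw
  set Q : ℕ := (64 * 130 ^ 2) ^ k * (1024 * M) ^ 3 * (128 * k ^ 2 * w) ^ (2 * k) with hQ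
  have hk0 : 0 < k := by omega
  have hw1 : 1 ≤ w := Nat.one_le_iff_ne_zero.2 (by positivity)
  have hQ1 : 1 ≤ Q := Nat.one_le_iff_ne_zero.2 (by positivity)
  have hMR : (1 : ℝ) ≤ M := by exact_mod_cast hM
  have hQR : (1 : ℝ) ≤ Q := by exact_mod_cast hQ1
  have hkR : (0 : ℝ) < k := by exact_mod_cast hk0
  have hwR : (0 : ℝ) < w := by exact_mod_cast hw1
  have hmR : (0 : ℝ) < m := by exact_mod_cast hm
  have hK0 : (1 : ℝ) ≤ K := by exact_mod_cast hK
  have hD0 : 0 < D := by linarith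
  -- The largest `g` with `128 * g ^ 3 * M ≤ D`: the overload loss stays affordable while `D` is at
  -- most a constant times `g ^ 3`.
  obtain ⟨g, hgQ, hg, hg'⟩ : ∃ g : ℕ, Q ≤ g ∧ 128 * (g ^ 3 * M : ℝ) ≤ D ∧
      D < 128 * ((g + 1) ^ 3 * M : ℝ) := by
    have hex : ∃ j : ℕ, D < 128 * ((j : ℝ) ^ 3 * M) := by
      obtain ⟨j, hj⟩ := exists_nat_gt D
      refine ⟨j, ?_⟩
      have hj1 : (1 : ℝ) ≤ j := by
        have : 0 < j := by exact_mod_cast hD0.trans hj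
        exact_mod_cast this
      have h3 : (j : ℝ) ≤ (j : ℝ) ^ 3 := le_self_pow₀ hj1 (by norm_num)
      nlinarith [mul_le_mul h3 hMR (by norm_num) (by positivity)]
    have hlt : ∀ j, j ≤ Q → ¬ D < 128 * ((j : ℝ) ^ 3 * M) := by
      intro j hj
      rw [not_lt]
      refine le_trans ?_ hD
      have : (j : ℝ) ≤ Q := by exact_mod_cast hj
      calc 128 * ((j : ℝ) ^ 3 * M) ≤ 128 * ((Q : ℝ) ^ 3 * M) := by gcongr
        _ = _ := by ring
    have hspec := Nat.find_spec hex
    have hQf : Q < Nat.find hex := by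
      by_contra h
      exact hlt _ (not_lt.1 h) hspec
    obtain ⟨g, hgf⟩ : ∃ g, Nat.find hex = g + 1 := ⟨Nat.find hex - 1, by omega⟩
    refine ⟨g, by omega, ?_, ?_⟩
    · have := Nat.find_min hex (m := g) (by omega)
      exact not_lt.1 this
    · rw [hgf] at hspec
      exact_mod_cast hspec
  have hg1 : (1 : ℝ) ≤ g := hQR.trans (by exact_mod_cast hgQ)
  have hg0 : (0 : ℝ) < g := by linarith
  have hgD : (g : ℝ) ≤ D := by
    have h3 : (g : ℝ) ≤ (g : ℝ) ^ 3 := le_self_pow₀ hg1 (by norm_num)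
    nlinarith [mul_le_mul h3 hMR (by norm_num) (by positivity)]
  have hDg : D ≤ 1024 * M * g ^ 3 := by
    have : ((g : ℝ) + 1) ^ 3 ≤ (2 * g) ^ 3 := by gcongr; linarith
    have := mul_le_mul_of_nonneg_right this (by linarith : (0 : ℝ) ≤ M)
    nlinarith
  set θ : ℝ := 130 * D / g with hθ
  have hθ1 : 1 ≤ θ := by rw [hθ, le_div_iff₀ hg0]; linarith
  have hgθ : g * θ = 130 * D := by rw [hθ]; field_simp
  set κ : ℕ := 64 * B + 64 ^ 4 * K with hκ
  have hκ1 : 1 ≤ κ := by omega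
  have hNpos : (0 : ℝ) < adjPairs G univ := by have := mul_pos hD0 hmR; linarith
  have hne : Nonempty (Darts G) := by
    rw [← Fintype.card_pos_iff, card_darts]
    exact_mod_cast hNpos
  have htot := card_mul_le_sum_dartMatrix (κ := κ) (θ := θ) (D := D) hst hsp hκ1 le_rfl
    (by linarith) (fun v => (hdeg v).trans_eq hgθ.symm) hm hn hD0 hN
    (by rw [hκ]; push_cast; linarith) hDK hg
  -- With this `γ`, the sparsity term and the collision term have equal size, and the final union
  -- bound comes to exactly `1 / 2`.
  set γ : ℝ := (128 * k ^ 2 * w)⁻¹ with hγ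
  have hγ0 : 0 < γ := by positivity
  refine prism_of_weighted_darts (A := dartMatrix G κ θ) (t := θ) (Δ := 130 * D) (d := D / 8)
    (γ := γ) (η := (64 * (k : ℝ) ^ 2)⁻¹) (w := w) dartMatrix_isSymm dartMatrix_nonneg
    (fun z => z.1.1) (fun z => z.1.2) (fun z => z.2)
    adj_of_dartMatrix_ne_zero (by linarith)
    (dartMatrix_fst_sum_le (by linarith)) (fun z v => (dartMatrix_snd_sum_le hκ1 z v).trans hθ1)
    (dartMatrix_row_sum_le hκ1 hdeg) (by linarith) (by rw [card_darts]; exact htot) hγ0.le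
    (by omega) ?_ hw1 ?_ ?_
  · have hNg : (adjPairs G univ : ℝ) ≤ (1024 * M) ^ 3 * g ^ 9 := by
      have hmD : (m : ℝ) ≤ D ^ 2 := by
        refine le_trans ?_ hDm
        have hB0 : (0 : ℝ) ≤ B := Nat.cast_nonneg _
        nlinarith [mul_le_mul_of_nonneg_right hK0 hmR.le, mul_nonneg hB0 hmR.le]
      calc (adjPairs G univ : ℝ) ≤ D * m := hN'
        _ ≤ D * D ^ 2 := mul_le_mul_of_nonneg_left hmD hD0.le
        _ = D ^ 3 := by ring
        _ ≤ (1024 * M * g ^ 3) ^ 3 := pow_le_pow_left₀ hD0.le hDg 3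
        _ = _ := by ring
    rw [card_darts]
    have hθD : θ * (130 * D) = 64 * 130 ^ 2 * (D / 8) ^ 2 / g := by rw [hθ]; ring
    have hγQ : (64 * 130 ^ 2 : ℝ) ^ k * (1024 * M) ^ 3 ≤ g * γ ^ (2 * k) := by
      have h1 : (64 * 130 ^ 2 : ℝ) ^ k * (1024 * M) ^ 3 = Q * γ ^ (2 * k) := by
        rw [hQ, hγ]
        push_cast
        rw [inv_pow, mul_assoc, mul_inv_cancel₀ (by positivity), mul_one]
        norm_num
      rw [h1]
      exact mul_le_mul_of_nonneg_right (by exact_mod_cast hgQ) (by positivity)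
    -- The only use of `10 ≤ k`: `g ^ 9` bounds the number of darts up to constants, and the extra
    -- factor `g ≥ Q` beats those constants.
    have hgk : (g : ℝ) ^ 9 * g ≤ g ^ k := by
      rw [← pow_succ]
      exact pow_le_pow_right₀ hg1 hk
    rw [hθD, div_pow, mul_pow, div_mul_eq_mul_div, div_le_iff₀ (by positivity)]
    calc (64 * 130 ^ 2 : ℝ) ^ k * ((D / 8) ^ 2) ^ k * adjPairs G univ
        ≤ (64 * 130 ^ 2 : ℝ) ^ k * ((D / 8) ^ 2) ^ k * ((1024 * M) ^ 3 * g ^ 9) := by gcongr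
      _ = (64 * 130 ^ 2 : ℝ) ^ k * (1024 * M) ^ 3 * (((D / 8) ^ 2) ^ k * g ^ 9) := by ring
      _ ≤ g * γ ^ (2 * k) * (((D / 8) ^ 2) ^ k * g ^ 9) := by gcongr
      _ = γ ^ (2 * k) * ((D / 8) ^ 2) ^ k * (g ^ 9 * g) := by ring
      _ ≤ γ ^ (2 * k) * ((D / 8) ^ 2) ^ k * g ^ k := by gcongr
      _ = (γ * (D / 8)) ^ (2 * k) * g ^ k := by rw [mul_pow, pow_mul (D / 8)]
  · intro W hW
    rw [← div_eq_inv_mul, le_div_iff₀ (by positivity)]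
    rcases le_or_gt ((256 * k ^ 2) ^ 4 * K) #W with h | h
    · have h1 := mul_adjPairs_le_sq (hsp W) (256 * k ^ 2) h
      have h2 : #W ^ 2 ≤ (2 * w) ^ 2 := Nat.pow_le_pow_left hW 2
      have h3 : 4 * (adjPairs G W * (64 * k ^ 2)) ≤ 4 * w ^ 2 := by nlinarith
      have h4 : adjPairs G W * (64 * k ^ 2) ≤ w ^ 2 := by omega
      exact_mod_cast h4
    · have h1 := adjPairs_le_sq G W
      have h2 : adjPairs G W * (64 * k ^ 2) ≤ w ^ 2 := by
        calc adjPairs G W * (64 * k ^ 2) ≤ #W ^ 2 * (64 * k ^ 2) := Nat.mul_le_mul_right _ h1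
          _ ≤ ((256 * k ^ 2) ^ 4 * K) ^ 2 * (64 * k ^ 2) := by gcongr
          _ = w ^ 2 := by rw [hw]; ring
      exact_mod_cast h2
  · have h1 : (w : ℝ) * γ = (128 * (k : ℝ) ^ 2)⁻¹ := by
      rw [hγ]
      field_simp
    have h2 : (2 * (k : ℝ)) ^ 2 * (4 * ((64 * (k : ℝ) ^ 2)⁻¹ + 2 * w * γ)) = 1 / 2 := by
      rw [mul_assoc 2, h1]
      field_simp
      norm_num
    rw [h2]
    norm_num

end

/-! ### Passage to the subgraph and the dependence on `s` -/

section
open scoped Classical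
open Finset

theorem adjPairs_induce {V : Type*} {G : SimpleGraph V} (W : Finset V) :
    adjPairs (G.induce (W : Set V)) univ = adjPairs G W := by
  refine card_bij (fun p _ => (p.1.1, p.2.1)) ?_ ?_ ?_
  · rintro ⟨a, b⟩ h
    simp only [mem_filter, SimpleGraph.comap_adj, Function.Embedding.subtype_apply] at h
    exact mem_filter.2 ⟨mem_product.2 ⟨a.2, b.2⟩, h.2⟩
  · rintro ⟨a, b⟩ _ ⟨a', b'⟩ _ h
    simp only [Prod.mk.injEq] at h
    exact Prod.ext (Subtype.ext h.1) (Subtype.ext h.2)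
  · rintro ⟨a, b⟩ h
    simp only [mem_filter, mem_product] at h
    exact ⟨(⟨a, h.1.1⟩, ⟨b, h.1.2⟩), by simpa using h.2, rfl⟩

theorem card_nbr_induce {V : Type*} {G : SimpleGraph V} (W : Finset V)
    (v : (W : Set V)) : #(nbr (G.induce (W : Set V)) v) = #{a ∈ W | G.Adj v a} := by
  refine card_bij (fun a _ => a.1) ?_ ?_ ?_
  · intro a h
    exact mem_filter.2 ⟨a.2, by simpa [mem_nbr] using h⟩
  · intro a _ b _ h
    exact Subtype.ext h
  · intro a h
    rw [mem_filter] at h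
    exact ⟨⟨a, h.1⟩, by simpa [mem_nbr] using h.2, rfl⟩

theorem induce_isIndContained {V : Type*} (G : SimpleGraph V) (W : Set V) :
    (G.induce W).IsIndContained G := ⟨SimpleGraph.Embedding.induce W⟩

theorem ncard_edgeSet_le_adjPairs {V : Type*} [Fintype V] (G : SimpleGraph V) :
    G.edgeSet.ncard ≤ adjPairs G univ := by
  have h : G.edgeSet ⊆ ((({p ∈ univ ×ˢ univ | G.Adj p.1 p.2} : Finset (V × V)).image
      fun p => s(p.1, p.2) : Finset (Sym2 V)) : Set (Sym2 V)) := by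
    intro e
    induction e with
    | _ a b =>
      intro h
      rw [SimpleGraph.mem_edgeSet] at h
      exact mem_coe.2 (mem_image.2 ⟨(a, b), by simpa using h, rfl⟩)
  refine (Set.ncard_le_ncard h (finite_toSet _)).trans ?_
  rw [Set.ncard_coe_finset]
  exact card_image_le

/-- The number of edges, relative to the `3/2`-th power of the number of vertices, above which
the argument applies. -/
def threshold {R : Type*} [CommSemiring R] (k : ℕ) (B M K : R) : R :=
  64 * (64 * B + 64 ^ 4 * K) + 128 * M * ((64 * 130 ^ 2) ^ k * (1024 * M) ^ 3 *
    (128 * (k : R) ^ 2 * ((256 * (k : R) ^ 2) ^ 4 * K * (8 * k))) ^ (2 * k)) ^ 3 +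
    32 * (64 ^ 4 * K)

theorem prism_of_many_adjPairs {V : Type*} [Fintype V] [Nonempty V] {G : SimpleGraph V} {s ℓ : ℕ}
    (hs : 1 ≤ s) (hℓ : 10 ≤ ℓ) (hG : (completeBipartiteGraph (Fin s) (Fin s)).Free G) {B M : ℕ}
    (hB : (2 * ℓ) * (2 * ℓ) * s * (4 * s) ^ ((2 * ℓ) ^ 2) < B)
    (hM : (2 * s) ^ (2 * ℓ) * ((2 * s) ^ (2 * ℓ) * ((2 * ℓ + 2) * s)) ≤ M)
    (hE : (threshold ℓ B M (128 * B ^ 3 * M) : ℕ) * (Fintype.card V : ℝ) ^ 3 ≤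
      (adjPairs G univ : ℝ) ^ 2) :
    (prismGraph (2 * ℓ)).IsIndContained G := by
  have hB1 : 1 ≤ B := by omega
  have hM1 : 1 ≤ M := le_trans (Nat.one_le_iff_ne_zero.2 (by positivity)) hM
  set K : ℕ := 128 * B ^ 3 * M with hK
  have hK1 : 1 ≤ K := Nat.one_le_iff_ne_zero.2 (by positivity)
  set T : ℕ := threshold ℓ B M K with hT
  have hT1 : 1 ≤ T := by
    rw [hT, threshold]
    omega
  have hn : (0 : ℝ) < Fintype.card V := by exact_mod_cast Fintype.card_pos
  have hTR : (1 : ℝ) ≤ T := by exact_mod_cast hT1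
  have hE0 : 0 < adjPairs G univ := by
    rw [Nat.pos_iff_ne_zero]
    intro h
    rw [h] at hE
    have : (0 : ℝ) < T * (Fintype.card V : ℝ) ^ 3 := by positivity
    norm_num at hE
    linarith
  obtain ⟨W, m, D, hm, hD, hWm, hDm, hgain, h1, h2, hdeg⟩ := exists_almost_regular_subset G hE0
  have hm0 : (0 : ℝ) < m := by exact_mod_cast hm
  have hTD : (T : ℝ) * m ≤ D ^ 2 := by
    have h := (mul_le_mul_of_nonneg_right hE hm0.le).trans hgain
    have h' : (Fintype.card V : ℝ) ^ 3 * (T * m) ≤ (Fintype.card V : ℝ) ^ 3 * D ^ 2 := by linarith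
    exact le_of_mul_le_mul_left h' (by positivity)
  -- From `T * m ≤ D ^ 2` and `D ≤ m`; so the lower bounds required of `D ^ 2 / m` and of `D` can be
  -- collected in a single threshold.
  have hTD' : (T : ℝ) ≤ D := by
    have h : (T : ℝ) * D ≤ D * D := by
      rw [← sq]
      exact (mul_le_mul_of_nonneg_left hDm (by linarith)).trans hTD
    exact le_of_mul_le_mul_right h hD
  refine SimpleGraph.IsIndContained.trans ?_ (induce_isIndContained G (W : Set V))
  by_contra hcon
  have hfree : (completeBipartiteGraph (Fin s) (Fin s)).Free (G.induce (W : Set V)) :=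
    fun h => hG (h.trans (induce_isIndContained G (W : Set V)).isContained)
  have hst : ∀ S : Finset (W : Set V),
      #{y | B ≤ #{a ∈ S | (G.induce (W : Set V)).Adj y a}} ≤ #S ^ 3 * M := fun S =>
    not_lt.1 fun h => hcon (prism_of_small_set hs (by omega) hfree S hB hM h)
  have hsp : ∀ S : Finset (W : Set V), adjPairs (G.induce (W : Set V)) S ^ 4 ≤ K * #S ^ 7 :=
    fun S => not_lt.1 fun h => hcon (prism_of_dense hs (by omega) hfree S hB hM h)
  obtain ⟨T1, T2, T3, hsum, hT1, hT2, hT3⟩ : ∃ T1 T2 T3 : ℕ, T = T1 + T2 + T3 ∧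
      T1 = 64 * (64 * B + 64 ^ 4 * K) ∧ T2 = 128 * M * ((64 * 130 ^ 2) ^ ℓ * (1024 * M) ^ 3 *
      (128 * ℓ ^ 2 * ((256 * ℓ ^ 2) ^ 4 * K * (8 * ℓ))) ^ (2 * ℓ)) ^ 3 ∧
      T3 = 32 * (64 ^ 4 * K) := ⟨_, _, _, by rw [hT, threshold]; rfl, rfl, rfl, rfl⟩
  have hT1' : (T1 : ℝ) ≤ T := by exact_mod_cast (by omega : T1 ≤ T)
  have hT2' : (T2 : ℝ) ≤ T := by exact_mod_cast (by omega : T2 ≤ T)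
  have hT3' : (T3 : ℝ) ≤ T := by exact_mod_cast (by omega : T3 ≤ T)
  refine hcon (prism_of_almost_regular (B := B) (M := M) (K := K) (D := D) hℓ hM1 hK1 hst hsp
    ?_ hm ?_ ?_ ?_ ?_ ?_ ?_)
  · intro v
    rw [card_nbr_induce]
    exact hdeg v v.2
  · simpa using hWm
  · rw [adjPairs_induce]
    exact h1
  · rw [adjPairs_induce]
    exact h2
  · refine le_trans ?_ ((mul_le_mul_of_nonneg_right hT1' hm0.le).trans hTD)
    rw [hT1]
    push_cast
    exact le_of_eq (by ring)
  · refine le_trans ?_ (hT2'.trans hTD')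
    rw [hT2]
    push_cast
    exact le_rfl
  · refine le_trans ?_ (hT3'.trans hTD')
    rw [hT3]
    push_cast
    exact le_of_eq (by ring)

/-- The base is `36 = 6 ^ 2` because the threshold is compared with the square of the number of
edges. -/
theorem exists_polynomial_eval_le_pow (p : Polynomial ℕ) :
    ∃ C : ℝ, 0 < C ∧ ∀ s : ℕ, ((p.eval s : ℕ) : ℝ) ≤ C * 36 ^ s := by
  have h := ((p.map (Nat.castRingHom ℝ)).tendsto_div_exp_atTop.comp
    tendsto_natCast_atTop_atTop).bddAbove_range
  obtain ⟨C, hC⟩ := h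
  refine ⟨max C 1, by positivity, fun s => ?_⟩
  have h1 := hC ⟨s, rfl⟩
  simp only [Function.comp_apply] at h1
  rw [div_le_iff₀ (Real.exp_pos _), Polynomial.eval_natCast_map] at h1
  have h2 : Real.exp s ≤ 36 ^ s := by
    rw [← mul_one (s : ℝ), Real.exp_nat_mul]
    exact pow_le_pow_left₀ (Real.exp_pos _).le (by linarith [Real.exp_one_lt_d9]) s
  calc ((p.eval s : ℕ) : ℝ) ≤ C * Real.exp s := h1
    _ ≤ max C 1 * Real.exp s := mul_le_mul_of_nonneg_right (le_max_left _ _) (Real.exp_pos _).le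
    _ ≤ max C 1 * 36 ^ s := mul_le_mul_of_nonneg_left h2 (by positivity)

theorem eval_threshold (k s : ℕ) (B M K : Polynomial ℕ) :
    (threshold k B M K).eval s = threshold k (B.eval s) (M.eval s) (K.eval s) := by
  simp [threshold]

end

/-- A `K_{s,s}`-free graph with sufficiently many edges contains an induced prism. -/
theorem mainTheorem8 (ℓ : ℕ) (hℓ : 10 ≤ ℓ) :
    ∃ C : ℝ, 0 < C ∧
      ∀ s : ℕ, 2 ≤ s →
        ∀ n : ℕ, 1 ≤ n →
          ∀ G : SimpleGraph (Fin n),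
            (completeBipartiteGraph (Fin s) (Fin s)).Free G →
            C * (6 : ℝ) ^ s * (s : ℝ) ^ (20 * ℓ ^ 2) * (n : ℝ) ^ (3 / 2 : ℝ)
                ≤ (G.edgeSet.ncard : ℝ) →
            (prismGraph (2 * ℓ)).IsIndContained G := by
  obtain ⟨pB, hpB⟩ : ∃ p : Polynomial ℕ, ∀ s : ℕ, p.eval s =
      (2 * ℓ) * (2 * ℓ) * s * (4 * s) ^ ((2 * ℓ) ^ 2) + 1 :=
    ⟨Polynomial.C ((2 * ℓ) * (2 * ℓ)) * Polynomial.X * (4 * Polynomial.X) ^ ((2 * ℓ) ^ 2) + 1,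
      by intro s; simp only [Polynomial.eval_mul, Polynomial.eval_pow, Polynomial.eval_add,
        Polynomial.eval_C, Polynomial.eval_X, Polynomial.eval_ofNat, Polynomial.eval_one]⟩
  obtain ⟨pM, hpM⟩ : ∃ p : Polynomial ℕ, ∀ s : ℕ, p.eval s =
      (2 * s) ^ (2 * ℓ) * ((2 * s) ^ (2 * ℓ) * ((2 * ℓ + 2) * s)) :=
    ⟨(2 * Polynomial.X) ^ (2 * ℓ) * ((2 * Polynomial.X) ^ (2 * ℓ) *
      (Polynomial.C (2 * ℓ + 2) * Polynomial.X)),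
      by intro s; simp only [Polynomial.eval_mul, Polynomial.eval_pow,
        Polynomial.eval_C, Polynomial.eval_X, Polynomial.eval_ofNat]⟩
  -- `threshold` makes sense in any commutative semiring, so it can be formed from polynomials in
  -- `s` and then evaluated.
  obtain ⟨C, hC0, hC⟩ := exists_polynomial_eval_le_pow (threshold ℓ pB pM (128 * pB ^ 3 * pM))
  refine ⟨Real.sqrt C, Real.sqrt_pos.2 hC0, fun s hs n hn G hG hE => ?_⟩
  have : Nonempty (Fin n) := ⟨⟨0, hn⟩⟩
  refine prism_of_many_adjPairs (by omega) hℓ hG (B := pB.eval s) (M := pM.eval s)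
    (by rw [hpB]; exact Nat.lt_succ_self _) (by rw [hpM]) ?_
  have hCs := hC s
  rw [eval_threshold] at hCs
  simp only [Polynomial.eval_mul, Polynomial.eval_pow, Polynomial.eval_ofNat] at hCs
  rw [Fintype.card_fin]
  -- The power of `s` is only needed to be at least 1, since the exponential factor already covers
  -- every polynomial.
  have hs1 : (1 : ℝ) ≤ (s : ℝ) ^ (20 * ℓ ^ 2) :=
    one_le_pow₀ (by exact_mod_cast (by omega : 1 ≤ s))
  have h1 : Real.sqrt C * 6 ^ s * (n : ℝ) ^ (3 / 2 : ℝ) ≤ adjPairs G Finset.univ := by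
    refine le_trans ?_ (hE.trans (by exact_mod_cast ncard_edgeSet_le_adjPairs G))
    refine mul_le_mul_of_nonneg_right ?_ (by positivity)
    exact le_mul_of_one_le_right (by positivity) hs1
  have h2 : ((n : ℝ) ^ (3 / 2 : ℝ)) ^ 2 = (n : ℝ) ^ 3 := by
    rw [← Real.rpow_natCast, ← Real.rpow_mul (Nat.cast_nonneg _), ← Real.rpow_natCast]
    norm_num
  calc _ ≤ C * 36 ^ s * (n : ℝ) ^ 3 := mul_le_mul_of_nonneg_right hCs (by positivity)
    _ = (Real.sqrt C * 6 ^ s * (n : ℝ) ^ (3 / 2 : ℝ)) ^ 2 := by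
        rw [mul_pow, mul_pow, h2, Real.sq_sqrt hC0.le, ← pow_mul, mul_comm s 2, pow_mul]
        norm_num
    _ ≤ _ := pow_le_pow_left₀ (by positivity) h1 2
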